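/- Let $M$ be a rank 2 lattice, $N$ its dual, and let $\Delta$ be the set of all lattice points of an integral polygon in $M_{\mathbb R}$ of dimension two (the polygon is also denoted $\Delta$). Let $P_\Sigma$ be the toric surface of the normal fan of $\Delta$, with the monomial sections $s_m$ $(m\in\Delta)$ of the associated line bundle $L_\Delta$. Fix $a_m\in\mathbb C$ with $|a_m|=1$ for all $m\in\Delta$. For $w=(w_m)\in\mathbb Z^\Delta$ and $\delta>0$ let $$s^{\delta^w}=\sum_{m\in\Delta}\delta^{w_m}a_m s_m,\qquad C_{s^{\delta^w}}=(s^{\delta^w})^{-1}(0)\subset P_\Sigma,\qquad F_{\delta^w}(x)=\sum_{m\in\Delta}\frac{|\delta^{w_m}s_m(x)|^2}{\sum_{m'\in\Delta}|\delta^{w_{m'}}s_{m'}(x)|^2}\,m\in\Delta .$$ A weight vector $w$ induces the regular subdivision $Z_w$ of $\Delta$ given by the projections of the faces of the lower convex hull of the graph of $w$; a cell is recorded by the set of those $m\in\Delta$ for which $(m,w_m)$ lies on the face. Let $\hat Z$ be the set of all regular simplicial decompositions $Z=Z_w$ with $w\in\mathbb Z^\Delta$ generic, i.e. such that every cell (of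 any dimension) is the vertex set of a simplex; the simplices may contain further lattice points. Let $A\subset\mathbb Z^\Delta$ be the lattice of (restrictions of) integral affine functions. For $Z\in\hat Z$ let $\tau_Z\subset(\mathbb Z^\Delta/A)\otimes\mathbb R$ be the closure of the set of classes $[w]$ with $Z_w=Z$. The $\tau_Z$ are the top dimensional cones of the secondary fan, a complete fan, whose toric variety $\overline{\mathcal M_\Delta}$ compactifies the torus $\mathcal M_\Delta=(\mathbb C^*)^\Delta/(\mathbb Z\oplus N)_{\mathbb C^*}$ of curves $C_s$, $s=\sum_m c_ms_m$ $(c_m\in\mathbb C^*)$, modulo torus action and scaling. Let $s_\infty^Z\in\overline{\mathcal M_\Delta}$ be the torus-fixed point of the cone $\tau_Z$ (the large complex limit point of $Z$). For a simplex $S\in Z$ put $C_S=\{x\in N_{\mathbb C^*}:\sum_{m\in S}a_ms_m(x)=0\}$ and $F_S(x)=\sum_{m\in S}\frac{|s_m(x)|^2}{\sum_{m'\in S}|s_{m'}(x)|^2}\,m$. Let $\Gamma_S$ be the union of the simplices of the barycentric subdivision of $S$ that contain no vertex of $S$, and let $\Gamma_Z=\bigcup_{S\in Z}\Gamma_S$,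 a graph in $\Delta$. A compact set $X\subset\Delta$ is called a fattening of $\Gamma_Z$ if $X\supset\Gamma_Z$, $X\cap\partial\Delta=\Gamma_Z\cap\partial\Delta$, and $\Gamma_Z$ is a strong deformation retract of $X$. **Theorem.** Let $Z\in\hat Z$ and $w\in\mathbb Z^\Delta$. If $C_{s^{\delta^w}}$ approaches the large complex limit point $s_\infty^Z$ in $\overline{\mathcal M_\Delta}$ as $\delta\to0^+$, then the amoebas $F_{\delta^w}(C_{s^{\delta^w}})$ converge to (a fattening of) the graph $\Gamma_Z$: in the Hausdorff distance, $$\lim_{\delta\to0^+}F_{\delta^w}(C_{s^{\delta^w}})=\bigcup_{S\in Z}F_S(C_S),$$ and $\bigcup_{S\in Z}F_S(C_S)$ is a fattening of $\Gamma_Z$. -/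

import Mathlib

open Filter Topology

noncomputable section

namespace Amoeba

/-! ### Toric varieties over `ℂ`, glued from their affine charts

`L` is the lattice of characters, and the real points of the dual lattice are the additive maps
`L →+ ℝ`. -/

section Toric

/-- `σ^∨ ∩ L`, the monoid of characters that are nonnegative on the cone `σ`. -/
def dualMonoid {L : Type*} [AddCommGroup L] (σ : Set (L →+ ℝ)) : AddSubmonoid L where
  carrier := {u | ∀ n ∈ σ, 0 ≤ n u}
  zero_mem' := fun n _ => by simp
  add_mem' := fun {u v} hu hv n hn => by
    simpa using add_nonneg (hu n hn) (hv n hn)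

/-- The complex torus `Hom(L, ℂ^*)`. -/
abbrev Torus (L : Type*) [AddCommGroup L] : Type _ := AddChar L ℂˣ

/-- The closed points of the affine toric variety `Spec ℂ[σ^∨ ∩ L]`, i.e. the monoid
homomorphisms from `σ^∨ ∩ L` to `(ℂ, ·)`. -/
abbrev Chart {L : Type*} [AddCommGroup L] (σ : Set (L →+ ℝ)) : Type _ :=
  AddChar (dualMonoid σ) ℂ

/-- The classical topology of an affine toric variety: pointwise convergence on characters. -/
instance chartTopology {L : Type*} [AddCommGroup L] (σ : Set (L →+ ℝ)) :
    TopologicalSpace (Chart σ) :=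
  TopologicalSpace.induced (fun χ : Chart σ => (χ : dualMonoid σ → ℂ)) inferInstance

/-- The restriction of a torus point to a chart: the open embedding of the torus. -/
def Chart.ofTorus {L : Type*} [AddCommGroup L] (σ : Set (L →+ ℝ)) (t : Torus L) : Chart σ where
  toFun u := (t (u : L) : ℂ)
  map_zero_eq_one' := by simp
  map_add_eq_mul' u v := by simp [AddChar.map_add_eq_mul]

open Classical in
/-- The distinguished point of the affine toric variety of `σ`: the character `u` takes the value
`1` if `u` vanishes on `σ`, and `0` otherwise. It is the torus-fixed point if `σ` has nonempty
interior. -/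
def Chart.distinguished {L : Type*} [AddCommGroup L] (σ : Set (L →+ ℝ)) : Chart σ where
  toFun u := if ∀ n ∈ σ, n (u : L) = 0 then 1 else 0
  map_zero_eq_one' := by simp
  map_add_eq_mul' u v := by
    have key : (∀ n ∈ σ, n ((u + v : dualMonoid σ) : L) = 0) ↔
        (∀ n ∈ σ, n (u : L) = 0) ∧ ∀ n ∈ σ, n (v : L) = 0 := by
      constructor
      · intro h
        have h' : ∀ n ∈ σ, n (u : L) = 0 ∧ n (v : L) = 0 := by
          intro n hn
          have h1 := h n hn
          have hu := u.2 n hn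
          have hv := v.2 n hn
          simp only [AddSubmonoid.coe_add, map_add] at h1
          constructor <;> linarith
        exact ⟨fun n hn => (h' n hn).1, fun n hn => (h' n hn).2⟩
      · rintro ⟨h1, h2⟩ n hn
        simp [h1 n hn, h2 n hn]
    simp only [key]
    by_cases h1 : ∀ n ∈ σ, n (u : L) = 0
    · by_cases h2 : ∀ n ∈ σ, n (v : L) = 0
      · rw [if_pos ⟨h1, h2⟩, if_pos h1, if_pos h2, one_mul]
      · rw [if_neg (fun h => h2 h.2), if_neg h2, mul_zero]
    · rw [if_neg (fun h => h1 h.1), if_neg h1, zero_mul]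

theorem dualMonoid_anti {L : Type*} [AddCommGroup L] {τ σ : Set (L →+ ℝ)} (h : τ ⊆ σ) :
    dualMonoid σ ≤ dualMonoid τ :=
  fun _ hu n hn => hu n (h hn)

/-- For `τ ⊆ σ`, the map of affine toric varieties `U_τ → U_σ`. -/
def Chart.map {L : Type*} [AddCommGroup L] {τ σ : Set (L →+ ℝ)} (h : τ ⊆ σ) (χ : Chart τ) :
    Chart σ where
  toFun u := χ ⟨u, dualMonoid_anti h u.2⟩
  map_zero_eq_one' := χ.map_zero_eq_one
  map_add_eq_mul' u v :=
    χ.map_add_eq_mul ⟨u, dualMonoid_anti h u.2⟩ ⟨v, dualMonoid_anti h v.2⟩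

/-- Points of two charts are glued if they come from one point of the chart of `σ i ∩ σ j`. -/
def Glue {L : Type*} [AddCommGroup L] {ι : Type*} (σ : ι → Set (L →+ ℝ))
    (p q : Σ i, Chart (σ i)) : Prop :=
  ∃ ψ : Chart (σ p.1 ∩ σ q.1),
    ψ.map Set.inter_subset_left = p.2 ∧ ψ.map Set.inter_subset_right = q.2

/-- The toric variety of the fan with maximal cones `σ i` (its closed points), glued from the
affine charts of the maximal cones along the charts of their intersections. -/
def ToricVariety {L : Type*} [AddCommGroup L] {ι : Type*} (σ : ι → Set (L →+ ℝ)) : Type _ :=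
  Quot (Glue σ)

/-- The inclusion of the chart of `σ i`. -/
def ToricVariety.mk {L : Type*} [AddCommGroup L] {ι : Type*} (σ : ι → Set (L →+ ℝ)) (i : ι)
    (χ : Chart (σ i)) : ToricVariety σ :=
  Quot.mk (Glue σ) ⟨i, χ⟩

/-- The classical topology of a toric variety, in which the open sets of the (open) affine charts
form a basis. -/
instance toricTopology {L : Type*} [AddCommGroup L] {ι : Type*} (σ : ι → Set (L →+ ℝ)) :
    TopologicalSpace (ToricVariety σ) :=
  TopologicalSpace.generateFrom
    {U | ∃ (i : ι) (V : Set (Chart (σ i))), IsOpen V ∧ U = ToricVariety.mk σ i '' V}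

/-- The embedding of the torus into a toric variety, written in the chart of `σ i`. -/
def ToricVariety.ofTorus {L : Type*} [AddCommGroup L] {ι : Type*} (σ : ι → Set (L →+ ℝ)) (i : ι)
    (t : Torus L) : ToricVariety σ :=
  ToricVariety.mk σ i (Chart.ofTorus (σ i) t)

/-- The embedding of the torus does not depend on the chart. -/
theorem ToricVariety.ofTorus_eq {L : Type*} [AddCommGroup L] {ι : Type*} (σ : ι → Set (L →+ ℝ))
    (i j : ι) (t : Torus L) : ToricVariety.ofTorus σ i t = ToricVariety.ofTorus σ j t :=
  Quot.sound ⟨Chart.ofTorus (σ i ∩ σ j) t, rfl, rfl⟩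

end Toric

/-! ### The Newton polygon and its toric surface -/

section Surface

/-- The rank two lattice `M`. -/
abbrev Lat : Type := Fin 2 → ℤ

/-- `M_ℝ`. -/
abbrev Pl : Type := Fin 2 → ℝ

/-- The inclusion `M ⊆ M_ℝ`. -/
def toPl (m : Lat) : Pl := fun i => (m i : ℝ)

/-- The polygon in `M_ℝ` spanned by a finite set of lattice points. -/
def polygon (Δ : Finset Lat) : Set Pl := convexHull ℝ (toPl '' (Δ : Set Lat))

/-- `Δ` is the set of all lattice points of an integral polygon (of dimension two). -/
def IsLatticePolygon (Δ : Finset Lat) : Prop :=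
  (∀ m : Lat, toPl m ∈ polygon Δ → m ∈ Δ) ∧ (interior (polygon Δ)).Nonempty

/-- The vertices of the polygon. -/
abbrev Vertex (Δ : Finset Lat) : Type :=
  {v : Δ // toPl (v : Lat) ∈ (polygon Δ).extremePoints ℝ}

/-- The normal cone `{n : ⟨v, n⟩ ≤ ⟨m, n⟩ for all m ∈ Δ}` of the vertex `v`. -/
def normalCone (Δ : Finset Lat) (v : Vertex Δ) : Set (Lat →+ ℝ) :=
  {n | ∀ m : Δ, n (v.1 : Lat) ≤ n (m : Lat)}

/-- The toric surface `P_Σ` of the normal fan `Σ` of the polygon. -/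
abbrev Surface (Δ : Finset Lat) : Type := ToricVariety (normalCone Δ)

theorem sub_mem_dual (Δ : Finset Lat) (v : Vertex Δ) (m : Δ) :
    (m : Lat) - (v.1 : Lat) ∈ dualMonoid (normalCone Δ v) := fun n hn => by
  simpa using hn m

/-- The value at `χ` of the section `s_m` of the line bundle `L_Δ`, trivialized by `s_v` on the
chart of the vertex `v`. -/
def sectionValue (Δ : Finset Lat) (p : Σ v : Vertex Δ, Chart (normalCone Δ v)) (m : Δ) : ℂ :=
  p.2 ⟨(m : Lat) - (p.1.1 : Lat), sub_mem_dual Δ p.1 m⟩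

/-- Changing the chart multiplies all sections by the same nonzero factor. -/
theorem sectionValue_glue (Δ : Finset Lat) (p q : Σ v : Vertex Δ, Chart (normalCone Δ v))
    (h : Glue (normalCone Δ) p q) :
    ∃ c : ℂ, c ≠ 0 ∧ ∀ m, sectionValue Δ q m = c * sectionValue Δ p m := by
  obtain ⟨i, χ⟩ := p
  obtain ⟨j, χ'⟩ := q
  obtain ⟨ψ, hp, hq⟩ := h
  dsimp only at ψ hp hq
  have hp' : ∀ u, χ u = ψ ⟨u, dualMonoid_anti Set.inter_subset_left u.2⟩ := fun u =>
    (DFunLike.congr_fun hp u).symm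
  have hq' : ∀ u, χ' u = ψ ⟨u, dualMonoid_anti Set.inter_subset_right u.2⟩ := fun u =>
    (DFunLike.congr_fun hq u).symm
  have h1 : ∀ (k l : Vertex Δ), (k = i ∨ k = j) → (l = i ∨ l = j) →
      (k.1 : Lat) - (l.1 : Lat) ∈ dualMonoid (normalCone Δ i ∩ normalCone Δ j) := by
    rintro k l (rfl | rfl) (rfl | rfl) n ⟨ha, hb⟩
    · simp
    · simpa using hb _
    · simpa using ha _
    · simp
  let A := (⟨_, h1 i j (Or.inl rfl) (Or.inr rfl)⟩ : dualMonoid (normalCone Δ i ∩ normalCone Δ j))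
  let B := (⟨_, h1 j i (Or.inr rfl) (Or.inl rfl)⟩ : dualMonoid (normalCone Δ i ∩ normalCone Δ j))
  refine ⟨ψ A, ?_, fun m => ?_⟩
  · intro h0
    have hAB : A + B = 0 := by ext; simp [A, B]
    have := ψ.map_add_eq_mul A B
    rw [hAB, h0, AddChar.map_zero_eq_one, zero_mul] at this
    exact one_ne_zero this
  · simp only [sectionValue, hp', hq']
    rw [← ψ.map_add_eq_mul]
    congr 1
    apply Subtype.ext
    change (m : Lat) - (j.1 : Lat) = (i.1 : Lat) - (j.1 : Lat) + ((m : Lat) - (i.1 : Lat))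
    abel

/-- The curve `C_s = s⁻¹(0) ⊆ P_Σ` of the section `s = ∑ c_m s_m`. -/
def curve (Δ : Finset Lat) (c : Δ → ℂ) : Set (Surface Δ) :=
  {x | Quot.liftOn x (fun p => ∑ m, c m * sectionValue Δ p m = 0) (by
    intro p q h
    obtain ⟨d, hd, hs⟩ := sectionValue_glue Δ p q h
    have : ∑ m, c m * sectionValue Δ q m = d * ∑ m, c m * sectionValue Δ p m := by
      rw [Finset.mul_sum]
      exact Finset.sum_congr rfl fun m _ => by rw [hs]; ring
    exact propext (by rw [this, mul_eq_zero, or_iff_right hd]))}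

/-- `∑_{m ∈ S} (|z_m|² / ∑_{m' ∈ S} |z_{m'}|²) m`. -/
def weightedMean {Δ : Finset Lat} (S : Finset Δ) (z : Δ → ℂ) : Pl :=
  ∑ m ∈ S, (‖z m‖ ^ 2 / ∑ m' ∈ S, ‖z m'‖ ^ 2) • toPl (m : Lat)

theorem weightedMean_mul {Δ : Finset Lat} (S : Finset Δ) (z : Δ → ℂ) (d : ℂ) (hd : d ≠ 0) :
    weightedMean S (fun m => d * z m) = weightedMean S z := by
  unfold weightedMean
  refine Finset.sum_congr rfl fun m _ => ?_
  congr 1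
  simp only [norm_mul, mul_pow, ← Finset.mul_sum]
  have : ‖d‖ ^ 2 ≠ 0 := by simpa using hd
  rw [mul_div_mul_left _ _ this]

/-- The moment map `x ↦ ∑_m ρ_m(x) m` of `P_Σ`, where `ρ_m = |k_m s_m|² / ∑_{m'} |k_{m'} s_{m'}|²`
for given weights `k_m`. -/
def momentMap (Δ : Finset Lat) (k : Δ → ℂ) : Surface Δ → Pl :=
  Quot.lift (fun p => weightedMean Finset.univ fun m => k m * sectionValue Δ p m) (by
    intro p q h
    obtain ⟨d, hd, hs⟩ := sectionValue_glue Δ p q h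
    rw [← weightedMean_mul Finset.univ (fun m => k m * sectionValue Δ p m) d hd]
    congr 1
    funext m
    rw [hs]
    ring)

/-- The coefficients `δ^{w_m} a_m` of `s^{δ^w}`. -/
def scaled {Δ : Finset Lat} (a : Δ → ℂˣ) (w : Δ → ℤ) (δ : Set.Ioi (0 : ℝ)) (m : Δ) : ℂˣ :=
  Units.mk0 ((δ : ℝ) : ℂ) (Complex.ofReal_ne_zero.mpr (ne_of_gt δ.2)) ^ w m * a m

/-- The amoeba `F_{δ^w}(C_{s^{δ^w}})`, a subset of the polygon. -/
def amoeba (Δ : Finset Lat) (a : Δ → ℂˣ) (w : Δ → ℤ) (δ : Set.Ioi (0 : ℝ)) : Set Pl :=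
  momentMap Δ (fun m => ((δ : ℝ) : ℂ) ^ w m) '' curve Δ (fun m => (scaled a w δ m : ℂ))

end Surface

/-! ### The secondary fan and the compactified moduli space of curves -/

section Secondary

/-- The regular subdivision of the polygon induced by `w`: its cells are the projections of the
faces of the lower convex hull of the graph of `w`. A cell is recorded by the set of the points
of `Δ` whose lifts lie on the face; cells of all dimensions are included. -/
def subdivision {Δ : Finset Lat} (w : Δ → ℝ) : Set (Finset Δ) :=
  {S | ∃ n : Lat →+ ℝ, ∀ m : Δ, m ∈ S ↔ ∀ m' : Δ, w m + n (m : Lat) ≤ w m' + n (m' : Lat)}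

/-- Every cell is a simplex, and only its vertices lie on the lifted face. -/
def IsSimplicial {Δ : Finset Lat} (Z : Set (Finset Δ)) : Prop :=
  ∀ S ∈ Z, AffineIndependent ℝ (fun m : S => toPl ((m : Δ) : Lat))

/-- The set of all regular simplicial decompositions of the polygon, i.e. of the decompositions
`Z_w` for generic integral `w`. A simplex is the set of its vertices. -/
abbrev RegularTriangulation (Δ : Finset Lat) : Type :=
  {Z : Set (Finset Δ) // IsSimplicial Z ∧ ∃ w : Δ → ℤ, Z = subdivision (fun m => (w m : ℝ))}

/-- The lattice of affine functions `m ↦ l + ⟨m, n⟩` on `Δ`. -/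
def affineFunctions (Δ : Finset Lat) : Set (Δ → ℤ) :=
  {w | ∃ (l : ℤ) (n : Lat →+ ℤ), ∀ m : Δ, w m = l + n (m : Lat)}

/-- `A^⊥ ⊆ ℤ^Δ`, the dual lattice of `ℤ^Δ / A` for the lattice `A` of affine functions. -/
def relations (Δ : Finset Lat) : AddSubgroup (Δ → ℤ) where
  carrier := {u | ∀ w ∈ affineFunctions Δ, ∑ m, u m * w m = 0}
  zero_mem' := fun w _ => by simp
  add_mem' := fun {u v} hu hv w hw => by
    simp only [Pi.add_apply, add_mul, Finset.sum_add_distrib, hu w hw, hv w hw, add_zero]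
  neg_mem' := fun {u} hu w hw => by
    simp only [Pi.neg_apply, neg_mul, Finset.sum_neg_distrib, hu w hw, neg_zero]

/-- The class in `(ℤ^Δ / A) ⊗ ℝ = Hom(A^⊥, ℝ)` of a real weight vector. -/
def weightClass {Δ : Finset Lat} (w : Δ → ℝ) : relations Δ →+ ℝ where
  toFun u := ∑ m, (u.1 m : ℝ) * w m
  map_zero' := by simp
  map_add' u v := by simp [add_mul, Finset.sum_add_distrib]

/-- The top dimensional cone `τ_Z` of the secondary fan: the closure of the set of the classes of
the weight vectors that induce `Z`. -/
def secondaryCone (Δ : Finset Lat) (Z : RegularTriangulation Δ) : Set (relations Δ →+ ℝ) :=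
  weightClass '' closure {w : Δ → ℝ | subdivision w = Z.1}

/-- The compactification of the toric moduli space of curves: the toric variety of the secondary
fan. -/
abbrev CompactModuli (Δ : Finset Lat) : Type := ToricVariety (secondaryCone Δ)

/-- The class of `C_s`, `s = ∑ c_m s_m`, in the toric moduli space
`(ℂ^*)^Δ / (ℤ ⊕ N) ⊗ ℂ^* = Hom(A^⊥, ℂ^*)`. -/
def curveClass {Δ : Finset Lat} (c : Δ → ℂˣ) : Torus (relations Δ) where
  toFun u := ∏ m, c m ^ u.1 m
  map_zero_eq_one' := by simp
  map_add_eq_mul' u v := by simp [zpow_add, Finset.prod_mul_distrib]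

/-- The point of the compactified moduli space given by `C_s`, `s = ∑ c_m s_m`; the result does not
depend on the chart `Z` in which it is written. -/
def moduliPoint {Δ : Finset Lat} (Z : RegularTriangulation Δ) (c : Δ → ℂˣ) : CompactModuli Δ :=
  ToricVariety.ofTorus (secondaryCone Δ) Z (curveClass c)

/-- The large complex limit point `s_∞^Z`: the torus-fixed point of the cone `τ_Z`. -/
def largeComplexLimit {Δ : Finset Lat} (Z : RegularTriangulation Δ) : CompactModuli Δ :=
  ToricVariety.mk (secondaryCone Δ) Z (Chart.distinguished (secondaryCone Δ Z))

end Secondary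

/-! ### The limit of the amoebas and the graph -/

section Graph

/-- The monomial `s_m` on the torus `N_{ℂ^*} = Hom(M, ℂ^*)`. -/
def monomial {Δ : Finset Lat} (x : Torus Lat) (m : Δ) : ℂ := (x (m : Lat) : ℂ)

/-- `F_S(C_S)`, where `C_S` is the zero set of `s_S = ∑_{m ∈ S} a_m s_m` in the torus and `F_S` is
the moment map with only the terms `m ∈ S`. -/
def simplexAmoeba {Δ : Finset Lat} (a : Δ → ℂˣ) (S : Finset Δ) : Set Pl :=
  (fun x : Torus Lat => weightedMean S (monomial x)) ''
    {x | ∑ m ∈ S, (a m : ℂ) * monomial x m = 0}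

/-- `⋃_{S ∈ Z} F_S(C_S)`. -/
def limitAmoeba {Δ : Finset Lat} (a : Δ → ℂˣ) (Z : Set (Finset Δ)) : Set Pl :=
  ⋃ S ∈ Z, simplexAmoeba a S

/-- The barycenter of the simplex with vertex set `T`. -/
def barycenter {Δ : Finset Lat} (T : Finset Δ) : Pl :=
  (T.card : ℝ)⁻¹ • ∑ m ∈ T, toPl (m : Lat)

/-- `Γ_S`: the union of the simplices of the barycentric subdivision of `S` that contain no vertex
of `S`. Simplices of the barycentric subdivision correspond to chains of faces of `S`, and the
vertices of `S` are the faces with one element. -/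
def simplexGraph {Δ : Finset Lat} (S : Finset Δ) : Set Pl :=
  ⋃ C ∈ {C : Set (Finset Δ) | IsChain (· ⊆ ·) C ∧ ∀ T ∈ C, T ⊆ S ∧ 2 ≤ T.card},
    convexHull ℝ (barycenter '' C)

/-- The graph `Γ_Z = ⋃_{S ∈ Z} Γ_S`. -/
def graph {Δ : Finset Lat} (Z : Set (Finset Δ)) : Set Pl :=
  ⋃ S ∈ Z, simplexGraph S

/-- `X` is a fattening, inside the polygon `P`, of the graph `Γ`: it is a compact subset of `P`
that contains `Γ`, has the same (external) points on the boundary of `P`, and has `Γ` as a strong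
deformation retract. -/
def IsFattening (P X Γ : Set Pl) : Prop :=
  IsCompact X ∧ X ⊆ P ∧ Γ ⊆ X ∧ X ∩ frontier P = Γ ∩ frontier P ∧
    ∃ H : ℝ × Pl → Pl, ContinuousOn H (Set.Icc (0 : ℝ) 1 ×ˢ X) ∧
      (∀ t ∈ Set.Icc (0 : ℝ) 1, ∀ x ∈ X, H (t, x) ∈ X) ∧
      (∀ x ∈ X, H (0, x) = x) ∧
      (∀ x ∈ X, H (1, x) ∈ Γ) ∧
      ∀ t ∈ Set.Icc (0 : ℝ) 1, ∀ x ∈ Γ, H (t, x) = x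

end Graph

end Amoeba

end

/-!
The hypothesis on the limit point is first translated into combinatorics. Near the fixed point of
the cone `τ_Z`, every character that is nonnegative and not identically zero on `τ_Z` is small. The
circuits that express a lattice point by the vertices of a triangle of `Z` are such characters, and
their smallness says that `w` lies strictly above its affine interpolation over each triangle of
`Z`; hence `w` itself induces `Z` (`subdivision_eq_of_tendsto`). Reading a torus point off a glued
chart uses that the cones of the secondary fan are strongly convex.

Since the triangles of `Z` cover the polygon (`exists_triangle`), each point of the polygon has
barycentric coordinates with respect to `Z`, which vary continuously. In these coordinates
everything becomes explicit. A point with coordinates `μ` lies in the limit amoeba if and only if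
the numbers `√μ_m` are the side lengths of a closed polygon, `2 √μ_m ≤ ∑ √μ_k` (`limitAmoeba_eq`):
monomials of a simplex take arbitrary values on the torus, so only the moduli restrict the
solutions of `∑ a_m s_m = 0`. It lies in the graph if and only if its largest coordinate is attained
at least twice (`graph_eq`). Lowering the largest coordinate linearly to the second largest one,
up to normalization, is the strong deformation retraction (`isFattening_limitAmoeba`).

For the convergence, let `μ` be the weights of a point of the amoeba. They satisfy the same polygon
inequalities. If `T` lies in no cell, then an integral relation between `T` and the vertices of the
triangle that contains its barycenter turns into a binomial equation of the sections, which gives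
`(∏_T μ_m)^N ≤ δ` (`prod_massWeights_le`). So limits of such weights are supported in cells, and by
compactness the amoebas enter every neighborhood of the limit (`eventually_amoeba_subset`).
Conversely, let `x` be a zero of `∑_S a_m s_m` for a cell `S`. If `g` is the linear part of the
affine function that supports `S`, then the substitution `x ↦ δ^g x` turns the equation of the curve
into a small perturbation of the equation of `C_S`, and a simple zero along a suitable
one-parameter family persists (`eventually_exists_zero`, `eventually_nonempty_inter`).
-/

namespace Amoeba

/-! ### Convex combinations of lattice points and cells of a subdivision -/

section Cells

variable {Δ : Finset Lat}

/-- The point `∑ μ_m m` of the plane with weights `μ`. -/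
noncomputable def combo (Δ : Finset Lat) : (Δ → ℝ) →ₗ[ℝ] Pl :=
  Fintype.linearCombination ℝ fun m : Δ => toPl (m : Lat)

theorem combo_apply (μ : Δ → ℝ) : combo Δ μ = ∑ m, μ m • toPl (m : Lat) := rfl

theorem continuous_combo : Continuous (combo Δ) :=
  (combo Δ).continuous_of_finiteDimensional

theorem map_combo {E : Type*} [AddCommGroup E] [Module ℝ E] (g : Pl →ₗ[ℝ] E) (μ : Δ → ℝ) :
    g (combo Δ μ) = ∑ m, μ m • g (toPl (m : Lat)) := by
  simp [combo_apply]

/-- The probability weights on `Δ` that are carried by `S`. -/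
def faceWeights (S : Finset Δ) : Set (Δ → ℝ) :=
  {μ | μ ∈ stdSimplex ℝ Δ ∧ ∀ m ∉ S, μ m = 0}

theorem isCompact_faceWeights (S : Finset Δ) : IsCompact (faceWeights S) := by
  refine (isCompact_stdSimplex ℝ Δ).inter_right (t := {μ | ∀ m ∉ S, μ m = 0}) ?_
  simp only [Set.ofPred_forall]
  exact isClosed_iInter fun m => isClosed_iInter fun _ =>
    isClosed_eq (continuous_apply m) continuous_const

theorem convex_faceWeights (S : Finset Δ) : Convex ℝ (faceWeights S) := by
  intro x hx y hy a b ha hb hab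
  refine ⟨convex_stdSimplex ℝ Δ hx.1 hy.1 ha hb hab, fun m hm => ?_⟩
  simp [hx.2 m hm, hy.2 m hm]

theorem single_mem_faceWeights [DecidableEq Δ] {S : Finset Δ} {m : Δ} (hm : m ∈ S) :
    Pi.single m 1 ∈ faceWeights S := by
  refine ⟨single_mem_stdSimplex ℝ m, fun k hk => ?_⟩
  rw [Pi.single_eq_of_ne]
  rintro rfl
  exact hk hm

theorem combo_single [DecidableEq Δ] (m : Δ) : combo Δ (Pi.single m 1) = toPl (m : Lat) := by
  simp [combo]

/-- The uniform weights on `T`. -/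
noncomputable def uniformWeights (T : Finset Δ) (m : Δ) : ℝ :=
  open Classical in if m ∈ T then (T.card : ℝ)⁻¹ else 0

theorem uniformWeights_mem {T S : Finset Δ} (hT : T.Nonempty) (hTS : T ⊆ S) :
    uniformWeights T ∈ faceWeights S := by
  classical
  refine ⟨⟨fun m => ?_, ?_⟩, fun m hm => if_neg fun h => hm (hTS h)⟩
  · unfold uniformWeights
    split_ifs <;> positivity
  · unfold uniformWeights
    rw [Finset.sum_ite_mem, Finset.univ_inter, Finset.sum_const, nsmul_eq_mul,
      mul_inv_cancel₀ (Nat.cast_ne_zero.2 hT.card_ne_zero)]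

theorem combo_uniformWeights (T : Finset Δ) : combo Δ (uniformWeights T) = barycenter T := by
  classical
  rw [combo_apply, barycenter, Finset.smul_sum, ← Finset.sum_subset (Finset.subset_univ T)]
  · exact Finset.sum_congr rfl fun m hm => by rw [uniformWeights, if_pos hm]
  · intro m _ hm
    rw [uniformWeights, if_neg hm, zero_smul]

theorem combo_image_faceWeights (S : Finset Δ) :
    combo Δ '' faceWeights S = convexHull ℝ ((fun m : Δ => toPl (m : Lat)) '' S) := by
  classical
  apply Set.Subset.antisymm
  · rintro _ ⟨μ, hμ, rfl⟩
    have : combo Δ μ = ∑ m ∈ S, μ m • toPl (m : Lat) := by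
      rw [combo_apply]
      refine (Finset.sum_subset (Finset.subset_univ S) fun m _ hm => ?_).symm
      rw [hμ.2 m hm, zero_smul]
    rw [this]
    refine (convex_convexHull ℝ _).sum_mem (fun m _ => hμ.1.1 m) ?_
      fun m hm => subset_convexHull ℝ _ ⟨m, hm, rfl⟩
    rw [← hμ.1.2]
    exact Finset.sum_subset (Finset.subset_univ S) fun m _ hm => hμ.2 m hm
  · refine convexHull_min ?_ ((convex_faceWeights S).linear_image _)
    rintro _ ⟨m, hm, rfl⟩
    exact ⟨Pi.single m 1, single_mem_faceWeights hm, combo_single m⟩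

theorem polygon_eq : polygon Δ = combo Δ '' stdSimplex ℝ Δ := by
  have h1 : polygon Δ = combo Δ '' faceWeights Finset.univ := by
    rw [combo_image_faceWeights, polygon]
    congr 1
    ext x
    simp
  rw [h1]
  congr 1
  ext μ
  simp [faceWeights]

theorem isCompact_polygon : IsCompact (polygon Δ) := by
  rw [polygon_eq]
  exact (isCompact_stdSimplex ℝ Δ).image continuous_combo

theorem IsLatticePolygon.nonempty (hΔ : IsLatticePolygon Δ) : Nonempty Δ := by
  obtain ⟨x, hx⟩ := hΔ.2
  have hx := interior_subset hx
  rw [polygon_eq] at hx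
  obtain ⟨μ, hμ, -⟩ := hx
  by_contra h
  rw [not_nonempty_iff] at h
  simpa using hμ.2

/-- The additive functions on the lattice are the restrictions of the linear functions. -/
theorem exists_linearMap_eq (n : Lat →+ ℝ) : ∃ g : Pl →ₗ[ℝ] ℝ, ∀ m : Lat, g (toPl m) = n m := by
  refine ⟨Fintype.linearCombination ℝ fun i : Fin 2 => n (Pi.single i 1), fun m => ?_⟩
  have hm : m = ∑ i, m i • (Pi.single i 1 : Lat) := by
    ext j
    fin_cases j <;> simp [Pi.single_apply]
  conv_rhs => rw [hm, map_sum]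
  rw [Fintype.linearCombination_apply]
  refine Finset.sum_congr rfl fun i _ => ?_
  rw [map_zsmul, zsmul_eq_mul]
  rfl

theorem toPl_add (u v : Lat) : toPl (u + v) = toPl u + toPl v := by
  ext i
  simp [toPl]

theorem toPl_zero : toPl 0 = 0 := by
  ext i
  simp [toPl]

/-- The restriction of a linear map to the lattice. -/
def restrict {E : Type*} [AddCommGroup E] [Module ℝ E] (g : Pl →ₗ[ℝ] E) : Lat →+ E where
  toFun m := g (toPl m)
  map_zero' := by rw [toPl_zero, map_zero]
  map_add' u v := by rw [toPl_add, map_add]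

/-- A cell of the subdivision is the contact set of `w` with an affine function below it. -/
theorem mem_subdivision_iff [Nonempty Δ] {w : Δ → ℝ} {S : Finset Δ} :
    S ∈ subdivision w ↔ S.Nonempty ∧ ∃ (g : Pl →ₗ[ℝ] ℝ) (c : ℝ), ∀ m : Δ,
      c ≤ w m + g (toPl (m : Lat)) ∧ (m ∈ S ↔ w m + g (toPl (m : Lat)) = c) := by
  constructor
  · rintro ⟨n, hn⟩
    obtain ⟨g, hg⟩ := exists_linearMap_eq n
    obtain ⟨m₀, hm₀⟩ := Finite.exists_min fun m : Δ => w m + n (m : Lat)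
    refine ⟨⟨m₀, (hn m₀).2 hm₀⟩, g, w m₀ + n (m₀ : Lat), fun m => ⟨?_, ?_⟩⟩
    · rw [hg]
      exact hm₀ m
    · rw [hg, hn]
      exact ⟨fun h => le_antisymm (h m₀) (hm₀ m), fun h m' => h ▸ hm₀ m'⟩
  · rintro ⟨⟨m₀, hm₀⟩, g, c, h⟩
    refine ⟨restrict g, fun m => ?_⟩
    change _ ↔ ∀ m' : Δ, w m + g (toPl (m : Lat)) ≤ w m' + g (toPl (m' : Lat))
    rw [(h m).2]
    refine ⟨fun hm m' => hm ▸ (h m').1, fun hm => le_antisymm ?_ (h m).1⟩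
    exact (hm m₀).trans_eq ((h m₀).2.1 hm₀)

/-- A function on affinely independent points is the restriction of an affine function. -/
theorem exists_affine_interpolation {E : Type*} [AddCommGroup E] [Module ℝ E] {S : Finset Δ}
    (hS : AffineIndependent ℝ (fun m : S => toPl ((m : Δ) : Lat))) (f : Δ → E) :
    ∃ (g : Pl →ₗ[ℝ] E) (c : E), ∀ m ∈ S, g (toPl (m : Lat)) + c = f m := by
  rcases S.eq_empty_or_nonempty with rfl | ⟨m₀, hm₀⟩
  · exact ⟨0, 0, by simp⟩
  rw [affineIndependent_iff_linearIndependent_vsub ℝ _ ⟨m₀, hm₀⟩] at hS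
  let b := Module.Basis.span hS
  obtain ⟨g, hg⟩ := LinearMap.exists_extend
    (b.constr ℝ fun i : {x : S // x ≠ ⟨m₀, hm₀⟩} => f i.1.1 - f m₀)
  have key : ∀ m ∈ S, g (toPl (m : Lat)) - g (toPl (m₀ : Lat)) = f m - f m₀ := by
    intro m hm
    by_cases h : m = m₀
    · simp [h]
    · let i : {x : S // x ≠ ⟨m₀, hm₀⟩} := ⟨⟨m, hm⟩, by simpa using h⟩
      have h1 := LinearMap.congr_fun hg (b i)
      rw [Module.Basis.constr_basis, LinearMap.comp_apply, Submodule.subtype_apply,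
        Module.Basis.span_apply] at h1
      rw [← map_sub]
      exact h1
  refine ⟨g, f m₀ - g (toPl (m₀ : Lat)), fun m hm => ?_⟩
  rw [← sub_add_cancel (f m) (f m₀), ← key m hm]
  abel

/-- Signed weights carried by an affinely independent set are determined by their total weight and
their weighted sum. -/
theorem eq_of_combo_eq {S : Finset Δ}
    (hS : AffineIndependent ℝ (fun m : S => toPl ((m : Δ) : Lat))) {μ ν : Δ → ℝ}
    (hμ : ∀ m ∉ S, μ m = 0) (hν : ∀ m ∉ S, ν m = 0) (hsum : ∑ m, μ m = ∑ m, ν m)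
    (h : combo Δ μ = combo Δ ν) : μ = ν := by
  classical
  funext m
  by_cases hm : m ∈ S
  · -- the affine function with values `1` at `m` and `0` at the other points reads off the weight
    obtain ⟨g, c, hg⟩ := exists_affine_interpolation hS (fun k => if k = m then (1 : ℝ) else 0)
    have key : ∀ ν : Δ → ℝ, (∀ m ∉ S, ν m = 0) → ν m = g (combo Δ ν) + (∑ k, ν k) * c := by
      intro ν hν
      have h1 : g (combo Δ ν) + (∑ k, ν k) * c = ∑ k, ν k • (g (toPl (k : Lat)) + c) := by
        rw [map_combo]
        simp only [smul_eq_mul, mul_add, Finset.sum_add_distrib, ← Finset.sum_mul]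
      rw [h1, Finset.sum_eq_single m, hg m hm]
      · simp
      · intro k _ hk
        by_cases hkS : k ∈ S
        · rw [hg k hkS, if_neg hk, smul_zero]
        · rw [hν k hkS, zero_smul]
      · simp
    rw [key μ hμ, key ν hν, h, hsum]
  · rw [hμ m hm, hν m hm]

theorem combo_injOn {S : Finset Δ}
    (hS : AffineIndependent ℝ (fun m : S => toPl ((m : Δ) : Lat))) {μ ν : Δ → ℝ}
    (hμ : μ ∈ faceWeights S) (hν : ν ∈ faceWeights S) (h : combo Δ μ = combo Δ ν) : μ = ν :=
  eq_of_combo_eq hS hμ.2 hν.2 (hμ.1.2.trans hν.1.2.symm) h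

/-- The lower convex hull is attained over a cell only by weights carried by that cell. -/
theorem faceWeights_of_combo_eq [Nonempty Δ] {w : Δ → ℝ} {S : Finset Δ} (hS : S ∈ subdivision w)
    {μ ν : Δ → ℝ} (hμ : μ ∈ stdSimplex ℝ Δ) (hν : ν ∈ faceWeights S)
    (h : combo Δ μ = combo Δ ν) :
    ∑ m, ν m * w m ≤ ∑ m, μ m * w m ∧
      (∑ m, μ m * w m ≤ ∑ m, ν m * w m → μ ∈ faceWeights S) := by
  obtain ⟨-, g, c, hg⟩ := mem_subdivision_iff.1 hS
  have h1 : ∀ ρ ∈ stdSimplex ℝ Δ, ∑ m, ρ m * (w m + g (toPl (m : Lat)) - c) =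
      ∑ m, ρ m * w m + g (combo Δ ρ) - c := by
    intro ρ hρ
    rw [map_combo]
    simp only [smul_eq_mul, mul_add, mul_sub, Finset.sum_add_distrib, Finset.sum_sub_distrib,
      ← Finset.sum_mul, hρ.2, one_mul]
  have h2 : ∑ m, ν m * (w m + g (toPl (m : Lat)) - c) = 0 := by
    refine Finset.sum_eq_zero fun m _ => ?_
    by_cases hm : m ∈ S
    · rw [(hg m).2.1 hm, sub_self, mul_zero]
    · rw [hν.2 m hm, zero_mul]
  have h3 : ∀ m, 0 ≤ μ m * (w m + g (toPl (m : Lat)) - c) := fun m =>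
    mul_nonneg (hμ.1 m) (sub_nonneg.2 (hg m).1)
  have h4 := h1 μ hμ
  have h5 := h1 ν hν.1
  rw [h] at h4
  refine ⟨?_, fun hle => ⟨hμ, fun m hm => ?_⟩⟩
  · have := Finset.sum_nonneg fun m (_ : m ∈ Finset.univ) => h3 m
    linarith
  · have h0 : ∑ m, μ m * (w m + g (toPl (m : Lat)) - c) = 0 :=
      le_antisymm (by linarith) (Finset.sum_nonneg fun m _ => h3 m)
    have h6 := (Finset.sum_eq_zero_iff_of_nonneg fun m _ => h3 m).1 h0 m (Finset.mem_univ m)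
    rcases mul_eq_zero.1 h6 with h7 | h7
    · exact h7
    · exact absurd ((hg m).2.2 (sub_eq_zero.1 h7)) hm

/-- Weights carried by two cells with the same barycenter are carried by both cells. -/
theorem faceWeights_of_mem_subdivision [Nonempty Δ] {w : Δ → ℝ} {S T : Finset Δ}
    (hS : S ∈ subdivision w) (hT : T ∈ subdivision w) {μ ν : Δ → ℝ} (hμ : μ ∈ faceWeights T)
    (hν : ν ∈ faceWeights S) (h : combo Δ μ = combo Δ ν) : μ ∈ faceWeights S :=
  (faceWeights_of_combo_eq hS hμ.1 hν h).2 (faceWeights_of_combo_eq hT hν.1 hμ h.symm).1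

theorem exists_pos_forall_mul_le {ι : Type*} [Finite ι] (p : ι → Prop) (h d : ι → ℝ)
    (hd : ∀ i, p i → 0 < d i) : ∃ ε : ℝ, 0 < ε ∧ ∀ i, p i → ε * h i < d i := by
  have h1 : ∀ᶠ ε : ℝ in 𝓝[>] 0, ∀ i, p i → ε * h i < d i := by
    rw [eventually_all]
    intro i
    by_cases hi : p i
    · have h2 : Tendsto (fun ε : ℝ => ε * h i) (𝓝[>] 0) (𝓝 0) := by
        have : Tendsto (fun ε : ℝ => ε * h i) (𝓝 0) (𝓝 (0 * h i)) :=
          (continuous_id.mul continuous_const).tendsto 0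
        rw [zero_mul] at this
        exact this.mono_left nhdsWithin_le_nhds
      filter_upwards [h2.eventually (gt_mem_nhds (hd i hi))] with ε hε _ using hε
    · exact Eventually.of_forall fun ε h => absurd h hi
  obtain ⟨ε, h2, h3⟩ := (h1.and self_mem_nhdsWithin).exists
  exact ⟨ε, h3, h2⟩

/-- The nonempty faces of a simplex of the subdivision are simplices of the subdivision. -/
theorem mem_subdivision_of_subset [Nonempty Δ] {w : Δ → ℝ} {S T : Finset Δ}
    (hS : S ∈ subdivision w) (hi : AffineIndependent ℝ (fun m : S => toPl ((m : Δ) : Lat)))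
    (hTS : T ⊆ S) (hT : T.Nonempty) : T ∈ subdivision w := by
  classical
  obtain ⟨-, g, c, hg⟩ := mem_subdivision_iff.1 hS
  -- tilt the supporting function by an affine function that vanishes on `T` and is `1` on `S \ T`
  obtain ⟨f, b, hf⟩ := exists_affine_interpolation hi (fun m => if m ∈ T then (0 : ℝ) else 1)
  obtain ⟨ε, hε, h⟩ := exists_pos_forall_mul_le (fun m : Δ => m ∉ S)
    (fun m => -(f (toPl (m : Lat)) + b)) (fun m => w m + g (toPl (m : Lat)) - c) (fun m hm => by
      have h1 := (hg m).1
      have h2 := fun h => hm ((hg m).2.2 h)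
      exact sub_pos.2 (lt_of_le_of_ne h1 (Ne.symm h2)))
  refine mem_subdivision_iff.2 ⟨hT, g + ε • f, c - ε * b, fun m => ?_⟩
  simp only [LinearMap.add_apply, LinearMap.smul_apply, smul_eq_mul]
  by_cases hm : m ∈ S
  · have h1 := (hg m).2.1 hm
    have h2 := hf m hm
    by_cases hmT : m ∈ T
    · rw [if_pos hmT] at h2
      have h3 : w m + (g (toPl (m : Lat)) + ε * f (toPl (m : Lat))) = c - ε * b := by
        linear_combination h1 + ε * h2
      exact ⟨h3.ge, fun _ => h3, fun _ => hmT⟩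
    · rw [if_neg hmT] at h2
      have h3 : w m + (g (toPl (m : Lat)) + ε * f (toPl (m : Lat))) = c - ε * b + ε := by
        linear_combination h1 + ε * h2
      exact ⟨by linarith, fun h => absurd h hmT, fun h => absurd h (by linarith)⟩
  · have h1 := h m hm
    exact ⟨by linarith, fun h => absurd (hTS h) hm, fun h => absurd h (by linarith)⟩

end Cells

/-! ### The cells of a subdivision cover the polygon -/

section Cover

variable {Δ : Finset Lat}

/-- An affine function that is at most `W` at the points of `Δ` is at most `W` on the polygon. -/
theorem dotProduct_add_le {v x : Pl} {t W : ℝ}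
    (h : ∀ m : Δ, v ⬝ᵥ (toPl (m : Lat) - x) + t ≤ W) {y : Pl} (hy : y ∈ polygon Δ) :
    v ⬝ᵥ (y - x) + t ≤ W := by
  rw [polygon_eq] at hy
  obtain ⟨μ, hμ, rfl⟩ := hy
  have h1 : v ⬝ᵥ (combo Δ μ - x) + t = ∑ m, μ m * (v ⬝ᵥ (toPl (m : Lat) - x) + t) := by
    simp only [mul_add, Finset.sum_add_distrib, ← Finset.sum_mul, hμ.2, one_mul, dotProduct_sub,
      mul_sub, Finset.sum_sub_distrib, combo_apply, dotProduct_sum, dotProduct_smul, smul_eq_mul]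
  calc _ = ∑ m, μ m * (v ⬝ᵥ (toPl (m : Lat) - x) + t) := h1
    _ ≤ ∑ m, μ m * W := Finset.sum_le_sum fun m _ => mul_le_mul_of_nonneg_left (h m) (hμ.1 m)
    _ = W := by rw [← Finset.sum_mul, hμ.2, one_mul]

/-- The affine functions below `w` with a lower bound for the value at an interior point of the
polygon form a compact set. -/
theorem isCompact_affine_minorants [Nonempty Δ] (w : Δ → ℝ) {x : Pl}
    (hx : x ∈ interior (polygon Δ)) (b : ℝ) :
    IsCompact {p : Pl × ℝ | (∀ m : Δ, p.1 ⬝ᵥ (toPl (m : Lat) - x) + p.2 ≤ w m) ∧ b ≤ p.2} := by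
  obtain ⟨m₁, hm₁⟩ := Finite.exists_max w
  obtain ⟨r, hr, hball⟩ := Metric.isOpen_iff.1 isOpen_interior x hx
  have hbound : ∀ (v : Pl) (t : ℝ), (∀ m : Δ, v ⬝ᵥ (toPl (m : Lat) - x) + t ≤ w m) → b ≤ t →
      ∀ (i : Fin 2) (s : ℝ), |s| < r → v i * s ≤ w m₁ - b := by
    intro v t h hb i s hs
    have hy : x + Pi.single i s ∈ polygon Δ := by
      refine interior_subset (hball ?_)
      rw [Metric.mem_ball, dist_eq_norm, add_sub_cancel_left]
      rwa [Pi.norm_single, Real.norm_eq_abs]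
    have h1 := dotProduct_add_le (fun m => (h m).trans (hm₁ m)) hy
    rw [add_sub_cancel_left, dotProduct_single] at h1
    linarith
  have hC : IsCompact ((Set.Icc (fun _ => -((w m₁ - b) / (r / 2)))
      (fun _ => (w m₁ - b) / (r / 2)) : Set Pl) ×ˢ Set.Icc b (w m₁)) :=
    isCompact_Icc.prod isCompact_Icc
  refine hC.of_isClosed_subset ?_ ?_
  · refine IsClosed.inter (s₁ := {p : Pl × ℝ | ∀ m : Δ, _}) ?_ ?_
    · simp only [Set.ofPred_forall]
      refine isClosed_iInter fun m => isClosed_le ?_ continuous_const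
      exact (continuous_fst.dotProduct continuous_const).add continuous_snd
    · exact isClosed_le continuous_const continuous_snd
  · rintro ⟨v, t⟩ ⟨h, hb⟩
    have h2 : |r / 2| < r := by rw [abs_of_pos (by linarith)]; linarith
    have h3 : |-(r / 2)| < r := by rwa [abs_neg]
    refine ⟨⟨fun i => ?_, fun i => ?_⟩, hb, ?_⟩
    · have := hbound v t h hb i _ h3
      rw [neg_le, le_div_iff₀ (by linarith)]
      dsimp only
      linarith
    · have := hbound v t h hb i _ h2
      rw [le_div_iff₀ (by linarith)]
      exact this
    · have h4 := dotProduct_add_le (fun m => (h m).trans (hm₁ m)) (interior_subset hx)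
      simpa using h4

/-- An affine function below `w` whose value at the interior point `x` is maximal touches `w` along
a cell that contains `x`: otherwise a function separating `x` from the cell could be added to it. -/
theorem exists_cell_of_mem_interior [Nonempty Δ] (w : Δ → ℝ) {x : Pl}
    (hx : x ∈ interior (polygon Δ)) : ∃ S ∈ subdivision w, x ∈ combo Δ '' faceWeights S := by
  classical
  obtain ⟨m₀, hm₀⟩ := Finite.exists_min w
  obtain ⟨⟨v, t⟩, ⟨hv, hb⟩, hmax⟩ := (isCompact_affine_minorants w hx (w m₀)).exists_isMaxOn
    ⟨(0, w m₀), by simpa using hm₀⟩ continuous_snd.continuousOn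
  let S : Finset Δ := Finset.univ.filter fun m => v ⬝ᵥ (toPl (m : Lat) - x) + t = w m
  have hmS : ∀ m, m ∈ S ↔ v ⬝ᵥ (toPl (m : Lat) - x) + t = w m := fun m => by simp [S]
  have hxS : x ∈ combo Δ '' faceWeights S := by
    by_contra hxS
    obtain ⟨f, u, hfx, hfS⟩ := geometric_hahn_banach_point_closed
      ((convex_faceWeights S).linear_image (combo Δ))
      ((isCompact_faceWeights S).image continuous_combo).isClosed hxS
    obtain ⟨ε, hε, hεm⟩ := exists_pos_forall_mul_le (fun m : Δ => m ∉ S)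
      (fun m => u - f (toPl (m : Lat))) (fun m => w m - (v ⬝ᵥ (toPl (m : Lat) - x) + t))
      (fun m hm => sub_pos.2 (lt_of_le_of_ne (hv m) fun h => hm ((hmS m).2 h)))
    let q : Pl := fun i => f (Pi.single i 1)
    have hq : ∀ y : Pl, q ⬝ᵥ y = f y := by
      intro y
      have hy : y = ∑ i, y i • (Pi.single i 1 : Pl) := by
        ext j
        fin_cases j <;> simp [Pi.single_apply]
      conv_rhs => rw [hy]
      simp only [map_sum, map_smul, smul_eq_mul, dotProduct, q]
      exact Finset.sum_congr rfl fun i _ => mul_comm _ _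
    have key : t + ε * (u - f x) ≤ t := by
      refine hmax (a := (v - ε • q, t + ε * (u - f x))) ⟨fun m => ?_, ?_⟩
      · have h1 : (v - ε • q) ⬝ᵥ (toPl (m : Lat) - x) + (t + ε * (u - f x)) =
            v ⬝ᵥ (toPl (m : Lat) - x) + t + ε * (u - f (toPl (m : Lat))) := by
          rw [sub_dotProduct, smul_dotProduct, hq, map_sub, smul_eq_mul]
          ring
        change (v - ε • q) ⬝ᵥ (toPl (m : Lat) - x) + (t + ε * (u - f x)) ≤ w m
        rw [h1]
        by_cases hm : m ∈ S
        · have h2 := hfS _ ⟨_, single_mem_faceWeights hm, combo_single m⟩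
          rw [(hmS m).1 hm]
          nlinarith
        · have := hεm m hm
          linarith
      · have : 0 < ε * (u - f x) := mul_pos hε (sub_pos.2 hfx)
        change w m₀ ≤ t + ε * (u - f x)
        linarith
    have : 0 < ε * (u - f x) := mul_pos hε (sub_pos.2 hfx)
    linarith
  refine ⟨S, mem_subdivision_iff.2 ⟨?_, -(dotProductBilin ℝ ℝ v), t - v ⬝ᵥ x, fun m => ?_⟩, hxS⟩
  · obtain ⟨μ, hμ, -⟩ := hxS
    by_contra h
    rw [Finset.not_nonempty_iff_eq_empty] at h
    have h1 := hμ.1.2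
    rw [Finset.sum_eq_zero fun m _ => hμ.2 m (by simp [h])] at h1
    exact zero_ne_one h1
  · have h1 := hv m
    have h2 := hmS m
    simp only [dotProduct_sub] at h1 h2
    have h3 : (-(dotProductBilin ℝ ℝ v)) (toPl (m : Lat)) = -(v ⬝ᵥ toPl (m : Lat)) := rfl
    rw [h3, h2]
    exact ⟨by linarith, by constructor <;> intro h <;> linarith⟩

/-- A cell of a simplicial subdivision with fewer than three points lies on a line. -/
theorem affineSpan_ne_top {S : Finset Δ}
    (hi : AffineIndependent ℝ (fun m : S => toPl ((m : Δ) : Lat))) (hS : S.card ≠ 3) :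
    affineSpan ℝ ((fun m : Δ => toPl (m : Lat)) '' S) ≠ ⊤ := by
  intro h
  rw [← show Set.range (fun m : S => toPl ((m : Δ) : Lat)) =
    (fun m : Δ => toPl (m : Lat)) '' S by ext; simp,
    hi.affineSpan_eq_top_iff_card_eq_finrank_add_one] at h
  simp at h
  exact hS h

/-- The triangles of a simplicial subdivision cover the polygon. -/
theorem exists_triangle (hΔ : IsLatticePolygon Δ) {w : Δ → ℝ}
    (hZ : IsSimplicial (subdivision w)) {x : Pl} (hx : x ∈ polygon Δ) :
    ∃ S ∈ subdivision w, S.card = 3 ∧ x ∈ combo Δ '' faceWeights S := by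
  classical
  have := hΔ.nonempty
  -- the union of the triangles is closed and contains the interior up to finitely many lines
  let C : Set Pl := ⋃ S ∈ {S : Finset Δ | S ∈ subdivision w ∧ S.card = 3},
    combo Δ '' faceWeights S
  have hC : IsClosed C := (Set.toFinite _).isClosed_biUnion fun S _ =>
    ((isCompact_faceWeights S).image continuous_combo).isClosed
  have hint : interior (polygon Δ) \ C ⊆ ⋃ S ∈ {S : Finset Δ | S ∈ subdivision w ∧ S.card ≠ 3},
      (affineSpan ℝ ((fun m : Δ => toPl (m : Lat)) '' S) : Set Pl) := by
    rintro y ⟨hy, hyC⟩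
    obtain ⟨S, hS, hyS⟩ := exists_cell_of_mem_interior w hy
    by_cases hc : S.card = 3
    · exact absurd (Set.mem_iUnion₂.2 ⟨S, ⟨hS, hc⟩, hyS⟩) hyC
    · rw [combo_image_faceWeights] at hyS
      exact Set.mem_iUnion₂.2 ⟨S, ⟨hS, hc⟩, convexHull_subset_affineSpan _ hyS⟩
  have hzero : MeasureTheory.volume (interior (polygon Δ) \ C) = 0 := by
    refine MeasureTheory.measure_mono_null hint
      ((MeasureTheory.measure_biUnion_null_iff (Set.to_countable _)).2 fun S hS => ?_)
    exact MeasureTheory.Measure.addHaar_affineSubspace _ _ (affineSpan_ne_top (hZ S hS.1) hS.2)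
  have hempty : interior (polygon Δ) \ C = ∅ :=
    (isOpen_interior.sdiff hC).eq_empty_of_measure_zero hzero
  have hsub : closure (interior (polygon Δ)) ⊆ C :=
    closure_minimal (Set.sdiff_eq_empty.1 hempty) hC
  have hconv : Convex ℝ (polygon Δ) := convex_convexHull ℝ _
  rw [hconv.closure_interior_eq_closure_of_nonempty_interior hΔ.2] at hsub
  obtain ⟨S, hS, hxS⟩ := Set.mem_iUnion₂.1 (hsub (subset_closure hx))
  exact ⟨S, hS.1, hS.2, hxS⟩

/-- Cramer's rule: the barycentric coordinates of the lattice points with respect to a lattice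
triangle have a common denominator. -/
theorem exists_integral_coordinates {S : Finset Δ}
    (hi : AffineIndependent ℝ (fun m : S => toPl ((m : Δ) : Lat))) (hS : S.card = 3) :
    ∃ N : ℤ, 0 < N ∧ ∀ m : Lat, ∃ c : Δ → ℤ, (∀ s ∉ S, c s = 0) ∧ ∑ s, c s = N ∧
      ∑ s, c s • (s : Lat) = N • m := by
  classical
  obtain ⟨p, q, r, hpq, hpr, hqr, rfl⟩ := Finset.card_eq_three.1 hS
  let D : ℤ := ((q : Lat) 0 - (p : Lat) 0) * ((r : Lat) 1 - (p : Lat) 1) -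
    ((q : Lat) 1 - (p : Lat) 1) * ((r : Lat) 0 - (p : Lat) 0)
  have hD : D ≠ 0 := by
    intro hD
    -- read off a vanishing combination of the edge vectors with an affine function
    have key : ∀ i : Fin 2, (q : Lat) i = (p : Lat) i := by
      obtain ⟨g, c, hg⟩ := exists_affine_interpolation hi (fun k => if k = r then (1 : ℝ) else 0)
      have h1 := hg p (by simp)
      have h2 := hg q (by simp)
      have h3 := hg r (by simp)
      rw [if_neg hpr] at h1
      rw [if_neg hqr] at h2
      rw [if_pos rfl] at h3
      have hD' : ((q : Lat) 0 - (p : Lat) 0 : ℝ) * ((r : Lat) 1 - (p : Lat) 1) -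
        ((q : Lat) 1 - (p : Lat) 1) * ((r : Lat) 0 - (p : Lat) 0) = 0 := by exact_mod_cast hD
      intro i
      have h4 : ((q : Lat) i - (p : Lat) i : ℝ) • (toPl (r : Lat) - toPl (p : Lat)) =
          ((r : Lat) i - (p : Lat) i : ℝ) • (toPl (q : Lat) - toPl (p : Lat)) := by
        ext j
        fin_cases i <;> fin_cases j <;> simp [toPl] <;> linarith
      have h5 := congrArg g h4
      rw [map_smul, map_smul, map_sub, map_sub,
        show g (toPl (r : Lat)) - g (toPl (p : Lat)) = 1 by linarith,
        show g (toPl (q : Lat)) - g (toPl (p : Lat)) = 0 by linarith] at h5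
      simp only [smul_eq_mul, mul_one, mul_zero] at h5
      have h6 : ((q : Lat) i : ℝ) = (p : Lat) i := by linarith
      exact_mod_cast h6
    exact hpq (Subtype.ext (funext fun i => (key i).symm))
  refine ⟨D * D, mul_self_pos.2 hD, fun m => ?_⟩
  let cq : ℤ := D * ((m 0 - (p : Lat) 0) * ((r : Lat) 1 - (p : Lat) 1) -
    (m 1 - (p : Lat) 1) * ((r : Lat) 0 - (p : Lat) 0))
  let cr : ℤ := D * (((q : Lat) 0 - (p : Lat) 0) * (m 1 - (p : Lat) 1) -
    ((q : Lat) 1 - (p : Lat) 1) * (m 0 - (p : Lat) 0))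
  refine ⟨Pi.single p (D * D - cq - cr) + Pi.single q cq + Pi.single r cr, ?_, ?_, ?_⟩
  · intro s hs
    simp only [Finset.mem_insert, Finset.mem_singleton, not_or] at hs
    simp [hs]
  · simp [Finset.sum_add_distrib]
    ring
  · simp only [Pi.add_apply, add_smul, Finset.sum_add_distrib, Pi.single_apply, ite_smul, zero_smul,
      Finset.sum_ite_eq', Finset.mem_univ, if_true]
    ext i
    fin_cases i <;> simp [cq, cr, D] <;> ring

end Cover

/-! ### Torus points in the charts of a toric variety -/

section ToricPoints

variable {L : Type*} [AddCommGroup L]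

/-- A torus point has only one representative in each chart, provided that the dual monoids
generate the lattice. -/
theorem ToricVariety.eq_ofTorus {ι : Type*} {σ : ι → Set (L →+ ℝ)}
    (hσ : ∀ i (l : L), ∃ u ∈ dualMonoid (σ i), l + u ∈ dualMonoid (σ i)) {i j : ι} {t : Torus L}
    {χ : Chart (σ j)} (h : ToricVariety.mk σ j χ = ToricVariety.ofTorus σ i t) :
    χ = Chart.ofTorus (σ j) t := by
  -- being the restriction of `t` is invariant under glueing, hence descends to the quotient
  have key : ∀ p q : Σ i, Chart (σ i), ∀ ψ : Chart (σ p.1 ∩ σ q.1),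
      ψ.map Set.inter_subset_left = p.2 → p.2 = Chart.ofTorus (σ p.1) t →
      ψ = Chart.ofTorus (σ p.1 ∩ σ q.1) t := by
    intro p q ψ h1 h2
    rw [h2] at h1
    have h3 : ∀ (u : L) (hu : u ∈ dualMonoid (σ p.1)),
        ψ ⟨u, dualMonoid_anti Set.inter_subset_left hu⟩ = t u := fun u hu =>
      DFunLike.congr_fun h1 (⟨u, hu⟩ : dualMonoid (σ p.1))
    refine DFunLike.ext _ _ fun l => ?_
    obtain ⟨u, hu, hlu⟩ := hσ p.1 (l : L)
    have h4 := ψ.map_add_eq_mul l ⟨u, dualMonoid_anti Set.inter_subset_left hu⟩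
    have h5 : l + ⟨u, dualMonoid_anti Set.inter_subset_left hu⟩ =
        (⟨(l : L) + u, dualMonoid_anti Set.inter_subset_left hlu⟩ :
          dualMonoid (σ p.1 ∩ σ q.1)) := rfl
    rw [h5, h3 _ hlu, h3 _ hu, AddChar.map_add_eq_mul, Units.val_mul] at h4
    exact (mul_right_cancel₀ (t u).ne_zero h4).symm
  have hP : ∀ p q : Σ i, Chart (σ i), Glue σ p q →
      (p.2 = Chart.ofTorus (σ p.1) t) = (q.2 = Chart.ofTorus (σ q.1) t) := by
    rintro p q ⟨ψ, h1, h2⟩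
    refine propext ⟨fun hp => ?_, fun hq => ?_⟩
    · rw [key p q ψ h1 hp] at h2
      rw [← h2]
      rfl
    · let e : Chart (σ q.1 ∩ σ p.1) := ψ.map (Set.inter_comm (σ p.1) (σ q.1)).le
      have h3 := key q p e h2 hq
      rw [← h1]
      refine DFunLike.ext _ _ fun u => ?_
      exact DFunLike.congr_fun h3 (⟨u, dualMonoid_anti Set.inter_subset_right u.2⟩ :
        dualMonoid (σ q.1 ∩ σ p.1))
  have h6 := congrArg (Quot.lift (fun p : Σ i, Chart (σ i) => p.2 = Chart.ofTorus (σ p.1) t) hP) h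
  exact h6.mpr rfl

/-- Along a family of torus points that tends to the distinguished point of a cone, a character
that is nonnegative and not identically zero on this cone has eventually modulus less than one. -/
theorem ToricVariety.eventually_norm_lt_one {ι α : Type*} {σ : ι → Set (L →+ ℝ)}
    (hσ : ∀ i (l : L), ∃ u ∈ dualMonoid (σ i), l + u ∈ dualMonoid (σ i)) {i : ι} {l : Filter α}
    {t : α → Torus L} (h : Tendsto (fun x => ToricVariety.ofTorus σ i (t x)) l
      (𝓝 (ToricVariety.mk σ i (Chart.distinguished (σ i)))))
    {u : L} (hu : u ∈ dualMonoid (σ i)) (hpos : ∃ n ∈ σ i, n u ≠ 0) :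
    ∀ᶠ x in l, ‖(t x u : ℂ)‖ < 1 := by
  let V : Set (Chart (σ i)) := {χ | ‖χ ⟨u, hu⟩‖ < 1}
  have hV : IsOpen V := by
    have h1 : Continuous fun χ : Chart (σ i) => χ ⟨u, hu⟩ :=
      (continuous_apply (⟨u, hu⟩ : dualMonoid (σ i))).comp continuous_induced_dom
    exact isOpen_lt h1.norm continuous_const
  have hd : Chart.distinguished (σ i) ∈ V := by
    have h1 : Chart.distinguished (σ i) ⟨u, hu⟩ = 0 := by
      obtain ⟨n, hn, hnu⟩ := hpos
      exact if_neg fun h => hnu (h n hn)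
    change ‖Chart.distinguished (σ i) ⟨u, hu⟩‖ < 1
    rw [h1]
    simp
  have hU : IsOpen (ToricVariety.mk σ i '' V) :=
    TopologicalSpace.isOpen_generateFrom_of_mem ⟨i, V, hV, rfl⟩
  filter_upwards [h (hU.mem_nhds ⟨_, hd, rfl⟩)] with x hx
  obtain ⟨χ, hχ, hχx⟩ := hx
  rw [ToricVariety.eq_ofTorus hσ hχx] at hχ
  exact hχ

end ToricPoints

/-! ### The secondary fan -/

section SecondaryFan

variable {Δ : Finset Lat}

theorem mem_relations_iff {u : Δ → ℤ} :
    u ∈ relations Δ ↔ ∑ m, u m = 0 ∧ ∑ m, u m • (m : Lat) = 0 := by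
  constructor
  · intro hu
    constructor
    · simpa using hu (fun _ => 1) ⟨1, 0, by simp⟩
    · ext i
      simpa using hu (fun m => (m : Lat) i) ⟨0, Pi.evalAddMonoidHom _ i, by simp⟩
  · rintro ⟨h1, h2⟩ w ⟨l, n, hw⟩
    simp only [hw, mul_add, Finset.sum_add_distrib, ← Finset.sum_mul, h1, zero_mul, zero_add]
    have h3 := congrArg n h2
    rw [map_sum, map_zero] at h3
    rw [← h3]
    exact Finset.sum_congr rfl fun m _ => by rw [map_zsmul, smul_eq_mul]

/-- Affine functions have class zero. -/
theorem weightClass_apply_eq (w : Δ → ℝ) (u : relations Δ) (g : Pl →ₗ[ℝ] ℝ) (c : ℝ) :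
    weightClass w u = ∑ m, (u.1 m : ℝ) * (w m + g (toPl (m : Lat)) - c) := by
  obtain ⟨h1, h2⟩ := mem_relations_iff.1 u.2
  have h3 : ∑ m, (u.1 m : ℝ) = 0 := by exact_mod_cast h1
  have h4 : ∑ m, (u.1 m : ℝ) * g (toPl (m : Lat)) = 0 := by
    have h5 := congrArg (restrict g) h2
    rw [map_sum, map_zero] at h5
    rw [← h5]
    exact Finset.sum_congr rfl fun m _ => by rw [map_zsmul, zsmul_eq_mul]; rfl
  simp only [mul_sub, mul_add, Finset.sum_add_distrib, Finset.sum_sub_distrib, ← Finset.sum_mul,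
    h3, h4, zero_mul, add_zero, sub_zero]
  rfl

/-- For a lattice triangle `S`, the circuits that express the points `m` by the vertices of `S`
measure by how much a weight at `m` exceeds the affine interpolation over `S`. -/
theorem exists_circuits {S : Finset Δ}
    (hi : AffineIndependent ℝ (fun m : S => toPl ((m : Δ) : Lat))) (hS : S.card = 3) :
    ∃ N : ℤ, 0 < N ∧ ∃ u : Δ → relations Δ, ∀ (m : Δ) (w : Δ → ℝ) (g : Pl →ₗ[ℝ] ℝ) (c : ℝ),
      (∀ s ∈ S, w s + g (toPl (s : Lat)) = c) →
      weightClass w (u m) = N * (w m + g (toPl (m : Lat)) - c) := by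
  classical
  obtain ⟨N, hN, h⟩ := exists_integral_coordinates hi hS
  choose k hk0 hk1 hk2 using h
  refine ⟨N, hN, fun m => ⟨Pi.single m N - k (m : Lat), mem_relations_iff.2 ⟨?_, ?_⟩⟩, ?_⟩
  · simp only [Pi.sub_apply, Finset.sum_sub_distrib, hk1, Finset.sum_pi_single', Finset.mem_univ,
      if_true, sub_self]
  · simp only [Pi.sub_apply, sub_smul, Finset.sum_sub_distrib, hk2, Pi.single_apply, ite_smul,
      zero_smul, Finset.sum_ite_eq', Finset.mem_univ, if_true, sub_self]
  · intro m w g c hw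
    rw [weightClass_apply_eq w _ g c]
    simp only [Pi.sub_apply, Int.cast_sub, sub_mul, Finset.sum_sub_distrib]
    rw [Finset.sum_eq_zero (f := fun s => (k (m : Lat) s : ℝ) * _), sub_zero]
    · simp [Pi.single_apply]
    · intro s _
      by_cases hs : s ∈ S
      · rw [hw s hs, sub_self, mul_zero]
      · rw [hk0 _ s hs, Int.cast_zero, zero_mul]

theorem mem_dualMonoid_secondaryCone {Z : RegularTriangulation Δ} {u : relations Δ}
    (h : ∀ w : Δ → ℝ, subdivision w = Z.1 → 0 ≤ weightClass w u) :
    u ∈ dualMonoid (secondaryCone Δ Z) := by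
  rintro _ ⟨w, hw, rfl⟩
  have hc : IsClosed {w : Δ → ℝ | 0 ≤ weightClass w u} := by
    refine isClosed_le continuous_const ?_
    change Continuous fun w : Δ → ℝ => ∑ m, (u.1 m : ℝ) * w m
    fun_prop
  exact closure_minimal (s := {w : Δ → ℝ | subdivision w = Z.1}) (fun w hw => h w hw) hc hw

theorem RegularTriangulation.exists_triangle (hΔ : IsLatticePolygon Δ)
    (Z : RegularTriangulation Δ) : ∃ S ∈ Z.1, S.card = 3 := by
  obtain ⟨w, hw⟩ := Z.2.2
  obtain ⟨x, hx⟩ := hΔ.2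
  obtain ⟨S, hS, hc, -⟩ := Amoeba.exists_triangle hΔ (hw ▸ Z.2.1) (interior_subset hx)
  exact ⟨S, hw ▸ hS, hc⟩

/-- The cones of the secondary fan are strongly convex: adding a large multiple of the circuits of
one triangle makes any relation nonnegative on the cone. -/
theorem exists_add_mem_dualMonoid (hΔ : IsLatticePolygon Δ) (Z : RegularTriangulation Δ)
    (v : relations Δ) : ∃ u ∈ dualMonoid (secondaryCone Δ Z),
      v + u ∈ dualMonoid (secondaryCone Δ Z) := by
  have := hΔ.nonempty
  obtain ⟨S, hS, hc⟩ := Z.exists_triangle hΔ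
  obtain ⟨N, hN, u, hu⟩ := exists_circuits (Z.2.1 S hS) hc
  obtain ⟨m₁, hm₁⟩ := Finite.exists_max fun m : Δ => |v.1 m|
  have hK : 0 ≤ |v.1 m₁| := abs_nonneg _
  have key : ∀ w : Δ → ℝ, subdivision w = Z.1 → ∃ d : Δ → ℝ, (∀ m, 0 ≤ d m) ∧
      weightClass w v = ∑ m, (v.1 m : ℝ) * d m ∧
      weightClass w (|v.1 m₁| • ∑ m, u m) = ∑ m, (|(v.1 m₁ : ℝ)| * N) * d m := by
    intro w hw
    obtain ⟨-, g, c, hg⟩ := mem_subdivision_iff.1 (hw ▸ hS : S ∈ subdivision w)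
    refine ⟨fun m => w m + g (toPl (m : Lat)) - c, fun m => sub_nonneg.2 (hg m).1,
      weightClass_apply_eq w v g c, ?_⟩
    rw [map_zsmul, map_sum, zsmul_eq_mul, Finset.mul_sum]
    refine Finset.sum_congr rfl fun m _ => ?_
    rw [hu m w g c fun s hs => (hg s).2.1 hs]
    push_cast
    ring
  have hN' : (1 : ℝ) ≤ N := by exact_mod_cast hN
  have hK' : (0 : ℝ) ≤ |(v.1 m₁ : ℝ)| := abs_nonneg _
  refine ⟨|v.1 m₁| • ∑ m, u m, mem_dualMonoid_secondaryCone fun w hw => ?_,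
    mem_dualMonoid_secondaryCone fun w hw => ?_⟩
  · obtain ⟨d, hd, -, h2⟩ := key w hw
    rw [h2]
    exact Finset.sum_nonneg fun m _ => mul_nonneg (mul_nonneg hK' (by linarith)) (hd m)
  · obtain ⟨d, hd, h1, h2⟩ := key w hw
    rw [map_add, h1, h2, ← Finset.sum_add_distrib]
    refine Finset.sum_nonneg fun m _ => ?_
    rw [← add_mul]
    refine mul_nonneg ?_ (hd m)
    have h3 : |(v.1 m : ℝ)| ≤ |(v.1 m₁ : ℝ)| := by exact_mod_cast hm₁ m
    have h4 := neg_abs_le (v.1 m : ℝ)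
    nlinarith

theorem zpow_sum₀ {ι : Type*} (s : Finset ι) {x : ℝ} (hx : x ≠ 0) (f : ι → ℤ) :
    x ^ (∑ i ∈ s, f i) = ∏ i ∈ s, x ^ f i := by
  classical
  induction s using Finset.induction_on with
  | empty => simp
  | insert i s hi ih => rw [Finset.sum_insert hi, Finset.prod_insert hi, zpow_add₀ hx, ih]

theorem norm_curveClass_scaled (a : Δ → ℂˣ) (ha : ∀ m, ‖(a m : ℂ)‖ = 1) (w : Δ → ℤ)
    (δ : Set.Ioi (0 : ℝ)) (u : relations Δ) :
    ‖(curveClass (scaled a w δ) u : ℂ)‖ = (δ : ℝ) ^ (∑ m, u.1 m * w m) := by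
  have hδ : (0 : ℝ) < δ := δ.2
  change ‖((∏ m, scaled a w δ m ^ u.1 m : ℂˣ) : ℂ)‖ = _
  rw [Units.coe_prod, norm_prod, zpow_sum₀ _ hδ.ne']
  refine Finset.prod_congr rfl fun m _ => ?_
  rw [Units.val_zpow_eq_zpow_val, scaled, Units.val_mul, Units.val_zpow_eq_zpow_val, norm_zpow,
    norm_mul, ha, mul_one, norm_zpow, Units.val_mk0, Complex.norm_real, Real.norm_of_nonneg hδ.le,
    ← zpow_mul, mul_comm]

theorem neBot_comap_Ioi : (comap ((↑) : Set.Ioi (0 : ℝ) → ℝ) (𝓝 0)).NeBot := by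
  rw [← mem_closure_iff_comap_neBot, closure_Ioi]
  exact Set.self_mem_Ici

/-- A triangle of `Z` is a cell of the subdivision of `w` if all its circuits are positive at
`w`. -/
theorem mem_subdivision_of_circuits [Nonempty Δ] {S : Finset Δ} {w : Δ → ℝ}
    (hi : AffineIndependent ℝ (fun m : S => toPl ((m : Δ) : Lat))) (hS : S.card = 3) {N : ℤ}
    (hN : 0 < N) {u : Δ → relations Δ} (hu : ∀ (m : Δ) (w : Δ → ℝ) (g : Pl →ₗ[ℝ] ℝ) (c : ℝ),
      (∀ s ∈ S, w s + g (toPl (s : Lat)) = c) →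
      weightClass w (u m) = N * (w m + g (toPl (m : Lat)) - c))
    (hpos : ∀ m ∉ S, 0 < weightClass w (u m)) : S ∈ subdivision w := by
  obtain ⟨g, b, hg⟩ := exists_affine_interpolation hi w
  have hN' : (0 : ℝ) < N := by exact_mod_cast hN
  have h0 : ∀ s ∈ S, w s + (-g) (toPl (s : Lat)) = b := fun s hs => by
    rw [← hg s hs, LinearMap.neg_apply]
    ring
  refine mem_subdivision_iff.2 ⟨Finset.card_pos.1 (by omega), -g, b, fun m => ?_⟩
  by_cases hm : m ∈ S
  · exact ⟨(h0 m hm).ge, fun _ => h0 m hm, fun _ => hm⟩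
  · have h1 := hpos m hm
    rw [hu m w (-g) b h0] at h1
    have h2 := (mul_pos_iff_of_pos_left hN').1 h1
    exact ⟨by linarith, fun h => absurd h hm, fun h => absurd h (by linarith)⟩

/-- Two subdivisions agree if one of them is simplicial and its triangles belong to the other. -/
theorem subdivision_eq_of_triangles (hΔ : IsLatticePolygon Δ) {w w' : Δ → ℝ}
    (hZ : IsSimplicial (subdivision w'))
    (h : ∀ S ∈ subdivision w', S.card = 3 → S ∈ subdivision w) :
    subdivision w = subdivision w' := by
  have := hΔ.nonempty
  -- the triangle that contains the barycenter of a cell `T` contains `T`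
  have key : ∀ T : Finset Δ, T.Nonempty → ∃ S ∈ subdivision w', S.card = 3 ∧
      ∀ w'', S ∈ subdivision w'' → T ∈ subdivision w'' → T ⊆ S := by
    intro T hT
    have hμ := uniformWeights_mem hT (subset_refl T)
    have hne : ∀ m ∈ T, uniformWeights T m ≠ 0 := fun m hm => by
      rw [uniformWeights, if_pos hm]
      exact inv_ne_zero (Nat.cast_ne_zero.2 hT.card_ne_zero)
    set μ := uniformWeights T
    obtain ⟨S, hS, hc, ν, hν, hνμ⟩ := exists_triangle hΔ hZ
      (polygon_eq (Δ := Δ) ▸ ⟨μ, hμ.1, rfl⟩ : combo Δ μ ∈ polygon Δ)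
    refine ⟨S, hS, hc, fun w'' hS' hT' m hm => ?_⟩
    by_contra hmS
    exact hne m hm ((faceWeights_of_mem_subdivision hS' hT' hμ hν hνμ.symm).2 m hmS)
  ext T
  constructor
  · intro hT
    have hne := (mem_subdivision_iff.1 hT).1
    obtain ⟨S, hS, hc, hTS⟩ := key T hne
    exact mem_subdivision_of_subset hS (hZ S hS) (hTS w (h S hS hc) hT) hne
  · intro hT
    have hne := (mem_subdivision_iff.1 hT).1
    obtain ⟨S, hS, hc, hTS⟩ := key T hne
    exact mem_subdivision_of_subset (h S hS hc) (hZ S hS) (hTS w' hS hT) hne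

/-- If the curves tend to the large complex limit point of `Z`, then the weight vector induces
`Z`. -/
theorem subdivision_eq_of_tendsto (hΔ : IsLatticePolygon Δ) (Z : RegularTriangulation Δ)
    (a : Δ → ℂˣ) (ha : ∀ m, ‖(a m : ℂ)‖ = 1) (w : Δ → ℤ)
    (hlim : Tendsto (fun δ : Set.Ioi (0 : ℝ) => moduliPoint Z (scaled a w δ))
      (comap ((↑) : Set.Ioi (0 : ℝ) → ℝ) (𝓝 0)) (𝓝 (largeComplexLimit Z))) :
    subdivision (fun m => (w m : ℝ)) = Z.1 := by
  have := hΔ.nonempty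
  obtain ⟨w', hw'⟩ := Z.2.2
  rw [hw']
  refine subdivision_eq_of_triangles hΔ (hw' ▸ Z.2.1) fun S hS hc => ?_
  have hSZ : S ∈ Z.1 := hw' ▸ hS
  have hi := Z.2.1 S hSZ
  obtain ⟨N, hN, u, hu⟩ := exists_circuits hi hc
  have hN' : (0 : ℝ) < N := by exact_mod_cast hN
  refine mem_subdivision_of_circuits hi hc hN hu fun m hm => ?_
  have hdual : u m ∈ dualMonoid (secondaryCone Δ Z) := by
    refine mem_dualMonoid_secondaryCone fun v hv => ?_
    obtain ⟨-, g, c, hg⟩ := mem_subdivision_iff.1 (hv ▸ hSZ : S ∈ subdivision v)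
    rw [hu m v g c fun s hs => (hg s).2.1 hs]
    exact mul_nonneg hN'.le (sub_nonneg.2 (hg m).1)
  have hne : ∃ n ∈ secondaryCone Δ Z, n (u m) ≠ 0 := by
    refine ⟨_, ⟨_, subset_closure hw'.symm, rfl⟩, ?_⟩
    obtain ⟨-, g, c, hg⟩ := mem_subdivision_iff.1 hS
    rw [hu m _ g c fun s hs => (hg s).2.1 hs]
    exact mul_ne_zero hN'.ne' (sub_ne_zero.2 fun h => hm ((hg m).2.2 h))
  have hlt := ToricVariety.eventually_norm_lt_one
    (fun Z v => exists_add_mem_dualMonoid hΔ Z v) hlim hdual hne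
  have := neBot_comap_Ioi
  have hsmall : ∀ᶠ δ : Set.Ioi (0 : ℝ) in comap (↑) (𝓝 (0 : ℝ)), (δ : ℝ) < 1 :=
    tendsto_comap.eventually (gt_mem_nhds one_pos)
  obtain ⟨δ, h1, h2⟩ := (hlt.and hsmall).exists
  rw [norm_curveClass_scaled a ha] at h1
  have h3 : 0 < ∑ k, (u m).1 k * w k := by
    by_contra h3
    rw [← not_le] at h1
    exact h1 (one_le_zpow_of_nonpos₀ δ.2 h2.le (not_lt.1 h3))
  change 0 < ∑ k, ((u m).1 k : ℝ) * (w k : ℝ)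
  exact_mod_cast h3

end SecondaryFan

/-! ### Barycentric coordinates of a triangulation -/

section Coordinates

variable {Δ : Finset Lat}

/-- The geometric realization of the simplicial complex `Z`: the weights carried by its cells. -/
def complexWeights (Z : Set (Finset Δ)) : Set (Δ → ℝ) := ⋃ S ∈ Z, faceWeights S

theorem mem_complexWeights {Z : Set (Finset Δ)} {μ : Δ → ℝ} :
    μ ∈ complexWeights Z ↔ ∃ S ∈ Z, μ ∈ faceWeights S := by
  simp [complexWeights]

theorem isCompact_complexWeights (Z : Set (Finset Δ)) : IsCompact (complexWeights Z) :=
  (Set.toFinite Z).isCompact_biUnion fun S _ => isCompact_faceWeights S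

theorem complexWeights_subset (Z : Set (Finset Δ)) : complexWeights Z ⊆ stdSimplex ℝ Δ := by
  intro μ hμ
  obtain ⟨S, -, h⟩ := mem_complexWeights.1 hμ
  exact h.1

theorem card_le_three {S : Finset Δ}
    (hi : AffineIndependent ℝ (fun m : S => toPl ((m : Δ) : Lat))) : S.card ≤ 3 := by
  have h1 := hi.card_le_finrank_succ
  have h2 := Submodule.finrank_le (vectorSpan ℝ (Set.range fun m : S => toPl ((m : Δ) : Lat)))
  simp only [Module.finrank_fintype_fun_eq_card, Fintype.card_fin, Fintype.card_coe] at h1 h2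
  omega

/-- A point of the complex lies in the relative interior of a cell. -/
theorem exists_cell_pos [Nonempty Δ] {w : Δ → ℝ} (hZ : IsSimplicial (subdivision w)) {μ : Δ → ℝ}
    (hμ : μ ∈ complexWeights (subdivision w)) :
    ∃ S ∈ subdivision w, μ ∈ faceWeights S ∧ ∀ m ∈ S, 0 < μ m := by
  classical
  obtain ⟨T, hT, h⟩ := mem_complexWeights.1 hμ
  refine ⟨Finset.univ.filter fun m => μ m ≠ 0, mem_subdivision_of_subset hT (hZ T hT) ?_ ?_,
    ⟨h.1, fun m hm => by simpa using hm⟩, fun m hm => ?_⟩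
  · intro m hm
    by_contra hmT
    exact (Finset.mem_filter.1 hm).2 (h.2 m hmT)
  · by_contra hne
    rw [Finset.not_nonempty_iff_eq_empty, Finset.filter_eq_empty_iff] at hne
    have h1 := h.1.2
    rw [Finset.sum_eq_zero fun m hm => not_not.1 (hne hm)] at h1
    exact zero_ne_one h1
  · exact lt_of_le_of_ne (h.1.1 m) (Finset.mem_filter.1 hm).2.symm

theorem combo_injOn_complexWeights [Nonempty Δ] {w : Δ → ℝ} (hZ : IsSimplicial (subdivision w)) :
    Set.InjOn (combo Δ) (complexWeights (subdivision w)) := by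
  intro μ hμ ν hν h
  obtain ⟨S, hS, hμS⟩ := mem_complexWeights.1 hμ
  obtain ⟨T, hT, hνT⟩ := mem_complexWeights.1 hν
  exact combo_injOn (hZ T hT) (faceWeights_of_mem_subdivision hT hS hμS hνT h) hνT h

theorem combo_image_complexWeights (hΔ : IsLatticePolygon Δ) {w : Δ → ℝ}
    (hZ : IsSimplicial (subdivision w)) :
    combo Δ '' complexWeights (subdivision w) = polygon Δ := by
  apply Set.Subset.antisymm
  · rw [polygon_eq]
    exact Set.image_mono (complexWeights_subset _)
  · intro x hx
    obtain ⟨S, hS, -, μ, hμ, h⟩ := exists_triangle hΔ hZ hx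
    exact ⟨μ, mem_complexWeights.2 ⟨S, hS, hμ⟩, h⟩

/-- The barycentric coordinates of the points of the polygon with respect to the complex `Z`. -/
noncomputable def coordinates (Z : Set (Finset Δ)) : Pl → Δ → ℝ :=
  Function.invFunOn (combo Δ) (complexWeights Z)

theorem coordinates_mem {Z : Set (Finset Δ)} {x : Pl} (hx : x ∈ combo Δ '' complexWeights Z) :
    coordinates Z x ∈ complexWeights Z := Function.invFunOn_mem hx

theorem combo_coordinates {Z : Set (Finset Δ)} {x : Pl} (hx : x ∈ combo Δ '' complexWeights Z) :
    combo Δ (coordinates Z x) = x := Function.invFunOn_eq hx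

theorem coordinates_combo {Z : Set (Finset Δ)} (hZ : Set.InjOn (combo Δ) (complexWeights Z))
    {μ : Δ → ℝ} (hμ : μ ∈ complexWeights Z) : coordinates Z (combo Δ μ) = μ :=
  hZ (coordinates_mem ⟨μ, hμ, rfl⟩) hμ (combo_coordinates ⟨μ, hμ, rfl⟩)

theorem continuousOn_coordinates {Z : Set (Finset Δ)}
    (hZ : Set.InjOn (combo Δ) (complexWeights Z)) :
    ContinuousOn (coordinates Z) (combo Δ '' complexWeights Z) := by
  rw [continuousOn_iff_isClosed]
  intro t ht
  refine ⟨combo Δ '' (complexWeights Z ∩ t),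
    (((isCompact_complexWeights Z).inter_right ht).image continuous_combo).isClosed, ?_⟩
  ext x
  constructor
  · rintro ⟨h1, h2⟩
    exact ⟨⟨coordinates Z x, ⟨coordinates_mem h2, h1⟩, combo_coordinates h2⟩, h2⟩
  · rintro ⟨⟨μ, ⟨h1, h2⟩, rfl⟩, h3⟩
    refine ⟨?_, h3⟩
    rw [Set.mem_preimage, coordinates_combo hZ h1]
    exact h2

end Coordinates

/-! ### The amoeba of a simplex -/

section SimplexAmoeba

variable {Δ : Finset Lat}

/-- The weights whose square roots satisfy the polygon inequalities, i.e. are the side lengths of a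
closed, possibly degenerate polygon. -/
def balanced (Δ : Finset Lat) : Set (Δ → ℝ) := {μ | ∀ m, 2 * √(μ m) ≤ ∑ k, √(μ k)}

theorem isClosed_balanced : IsClosed (balanced Δ) := by
  simp only [balanced, Set.ofPred_forall]
  exact isClosed_iInter fun m => isClosed_le (by fun_prop) (by fun_prop)

/-- The weights of the points of `S` in `weightedMean S z`. -/
noncomputable def massWeights (S : Finset Δ) (z : Δ → ℂ) (m : Δ) : ℝ :=
  open Classical in if m ∈ S then ‖z m‖ ^ 2 / ∑ k ∈ S, ‖z k‖ ^ 2 else 0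

theorem combo_massWeights (S : Finset Δ) (z : Δ → ℂ) :
    combo Δ (massWeights S z) = weightedMean S z := by
  classical
  rw [combo_apply, weightedMean, ← Finset.sum_subset (Finset.subset_univ S)]
  · exact Finset.sum_congr rfl fun m hm => by rw [massWeights, if_pos hm]
  · intro m _ hm
    rw [massWeights, if_neg hm, zero_smul]

theorem massWeights_mem_faceWeights {S : Finset Δ} {z : Δ → ℂ} (h : ∑ k ∈ S, ‖z k‖ ^ 2 ≠ 0) :
    massWeights S z ∈ faceWeights S := by
  classical
  refine ⟨⟨fun m => ?_, ?_⟩, fun m hm => if_neg hm⟩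
  · unfold massWeights
    split_ifs
    · exact div_nonneg (by positivity) (Finset.sum_nonneg fun k _ => by positivity)
    · rfl
  · unfold massWeights
    rw [Finset.sum_ite_mem, Finset.univ_inter, ← Finset.sum_div, div_self h]

theorem sqrt_massWeights (S : Finset Δ) (z : Δ → ℂ) (m : Δ) :
    √(massWeights S z m) =
      open Classical in if m ∈ S then ‖z m‖ / √(∑ k ∈ S, ‖z k‖ ^ 2) else 0 := by
  unfold massWeights
  split_ifs
  · rw [Real.sqrt_div (by positivity), Real.sqrt_sq (norm_nonneg _)]
  · exact Real.sqrt_zero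

/-- If the terms of a sum with coefficients of modulus one cancel, their moduli are balanced. -/
theorem massWeights_mem_balanced {S : Finset Δ} {z : Δ → ℂ} {a : Δ → ℂˣ}
    (ha : ∀ m, ‖(a m : ℂ)‖ = 1) (h : ∑ m ∈ S, (a m : ℂ) * z m = 0) :
    massWeights S z ∈ balanced Δ := by
  classical
  intro m
  simp only [sqrt_massWeights]
  rw [Finset.sum_ite_mem, Finset.univ_inter, ← Finset.sum_div]
  split_ifs with hm
  · rw [← mul_div_assoc]
    refine div_le_div_of_nonneg_right ?_ (Real.sqrt_nonneg _)
    rw [← Finset.add_sum_erase S _ hm] at h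
    have h1 : ‖z m‖ ≤ ∑ k ∈ S.erase m, ‖z k‖ := by
      calc ‖z m‖ = ‖(a m : ℂ) * z m‖ := by rw [norm_mul, ha, one_mul]
        _ = ‖∑ k ∈ S.erase m, (a k : ℂ) * z k‖ := by rw [eq_neg_of_add_eq_zero_left h, norm_neg]
        _ ≤ ∑ k ∈ S.erase m, ‖(a k : ℂ) * z k‖ := norm_sum_le _ _
        _ = ∑ k ∈ S.erase m, ‖z k‖ := Finset.sum_congr rfl fun k _ => by rw [norm_mul, ha, one_mul]
    rw [← Finset.add_sum_erase S _ hm]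
    linarith
  · rw [mul_zero]
    exact div_nonneg (Finset.sum_nonneg fun k _ => norm_nonneg _) (Real.sqrt_nonneg _)

/-- Three lengths that satisfy the triangle inequalities are the sides of a triangle. -/
theorem exists_phases_three {a b c : ℝ} (hc : 0 ≤ c) (h1 : a ≤ b + c)
    (h2 : b ≤ a + c) (h3 : c ≤ a + b) :
    ∃ u v : ℂ, ‖u‖ = 1 ∧ ‖v‖ = 1 ∧ (a : ℂ) + b * u + c * v = 0 := by
  -- turn the second side until the third side has the right length
  have hcont : Continuous fun t : ℝ => ‖(a : ℂ) + b * Complex.exp (t * Complex.I)‖ := by fun_prop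
  have hmem : c ∈ Set.Icc ‖(a : ℂ) + b * Complex.exp ((Real.pi : ℝ) * Complex.I)‖
      ‖(a : ℂ) + b * Complex.exp ((0 : ℝ) * Complex.I)‖ := by
    rw [Complex.exp_pi_mul_I, Complex.ofReal_zero, zero_mul, Complex.exp_zero]
    constructor
    · rw [show (a : ℂ) + b * -1 = ((a - b : ℝ) : ℂ) by push_cast; ring, Complex.norm_real,
        Real.norm_eq_abs, abs_le]
      constructor <;> linarith
    · rw [show (a : ℂ) + b * 1 = ((a + b : ℝ) : ℂ) by push_cast; ring, Complex.norm_real,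
        Real.norm_eq_abs]
      exact h3.trans (le_abs_self _)
  obtain ⟨t, -, ht⟩ := intermediate_value_Icc' Real.pi_pos.le hcont.continuousOn hmem
  dsimp only at ht
  rcases hc.eq_or_lt with rfl | hc
  · refine ⟨Complex.exp (t * Complex.I), 1, Complex.norm_exp_ofReal_mul_I t, norm_one, ?_⟩
    rw [norm_eq_zero] at ht
    rw [ht]
    simp
  · refine ⟨Complex.exp (t * Complex.I), -((a : ℂ) + b * Complex.exp (t * Complex.I)) / c,
      Complex.norm_exp_ofReal_mul_I t, ?_, ?_⟩
    · rw [norm_div, norm_neg, ht, Complex.norm_real, Real.norm_of_nonneg hc.le, div_self hc.ne']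
    · have : (c : ℂ) ≠ 0 := Complex.ofReal_ne_zero.2 hc.ne'
      field_simp
      ring

/-- At most three balanced lengths are the moduli of complex numbers with vanishing sum. -/
theorem exists_phases {ι : Type*} {S : Finset ι} (hS : S.card ≤ 3) {r : ι → ℝ}
    (hr : ∀ m, 0 ≤ r m) (h : ∀ m ∈ S, 2 * r m ≤ ∑ k ∈ S, r k) :
    ∃ θ : ι → ℂ, (∀ m, ‖θ m‖ = 1) ∧ ∑ m ∈ S, (r m : ℂ) * θ m = 0 := by
  classical
  obtain h0 | h1 | h2 | h3 : S.card = 0 ∨ S.card = 1 ∨ S.card = 2 ∨ S.card = 3 := by omega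
  · rw [Finset.card_eq_zero] at h0
    exact ⟨fun _ => 1, fun _ => norm_one, by simp [h0]⟩
  · obtain ⟨p, rfl⟩ := Finset.card_eq_one.1 h1
    have h4 := h p (by simp)
    have h5 := hr p
    rw [Finset.sum_singleton] at h4
    have h6 : r p = 0 := by linarith
    exact ⟨fun _ => 1, fun _ => norm_one, by simp [h6]⟩
  · obtain ⟨p, q, hpq, rfl⟩ := Finset.card_eq_two.1 h2
    have h4 := h p (by simp)
    have h5 := h q (by simp)
    rw [Finset.sum_pair hpq] at h4 h5
    have h6 : r p = r q := by linarith
    refine ⟨fun m => if m = p then 1 else -1, fun m => ?_, ?_⟩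
    · dsimp only
      split_ifs <;> simp
    · dsimp only
      rw [Finset.sum_pair hpq, if_pos rfl, if_neg hpq.symm, h6]
      ring
  · obtain ⟨p, q, s, hpq, hps, hqs, rfl⟩ := Finset.card_eq_three.1 h3
    have hsum : ∀ f : ι → ℂ, ∑ m ∈ {p, q, s}, f m = f p + f q + f s := fun f => by
      rw [Finset.sum_insert (by simp [hpq, hps]), Finset.sum_pair hqs, add_assoc]
    have hsum' : ∑ m ∈ {p, q, s}, r m = r p + r q + r s := by
      rw [Finset.sum_insert (by simp [hpq, hps]), Finset.sum_pair hqs, add_assoc]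
    rw [hsum'] at h
    have h4 := h p (by simp)
    have h5 := h q (by simp)
    have h6 := h s (by simp)
    obtain ⟨u, v, hu, hv, huv⟩ := exists_phases_three (a := r p) (b := r q) (hr s) (by linarith)
      (by linarith) (by linarith)
    refine ⟨fun m => if m = p then 1 else if m = q then u else v, fun m => ?_, ?_⟩
    · dsimp only
      split_ifs <;> simp [hu, hv]
    · rw [hsum]
      dsimp only
      rw [if_pos rfl, if_neg hpq.symm, if_pos rfl, if_neg hps.symm, if_neg hqs.symm, mul_one]
      exact huv

/-- The torus point with logarithms `n`. -/
noncomputable def expPoint (n : Lat →+ ℂ) : Torus Lat where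
  toFun u := Units.mk0 (Complex.exp (n u)) (Complex.exp_ne_zero _)
  map_zero_eq_one' := by
    ext
    simp
  map_add_eq_mul' u v := by
    ext
    simp [Complex.exp_add]

theorem monomial_expPoint (n : Lat →+ ℂ) (m : Δ) :
    monomial (expPoint n) m = Complex.exp (n (m : Lat)) := rfl

theorem monomial_ne_zero (x : Torus Lat) (m : Δ) : monomial x m ≠ 0 := (x (m : Lat)).ne_zero

theorem sum_norm_monomial_ne_zero {S : Finset Δ} (hS : S.Nonempty) (x : Torus Lat) :
    ∑ m ∈ S, ‖monomial x m‖ ^ 2 ≠ 0 :=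
  (Finset.sum_pos (fun m _ => pow_pos (norm_pos_iff.2 (monomial_ne_zero x m)) 2) hS).ne'

theorem weightedMean_congr {S : Finset Δ} {z z' : Δ → ℂ} (h : ∀ m ∈ S, z m = z' m) :
    weightedMean S z = weightedMean S z' := by
  have h1 : ∑ m ∈ S, ‖z m‖ ^ 2 = ∑ m ∈ S, ‖z' m‖ ^ 2 :=
    Finset.sum_congr rfl fun m hm => by rw [h m hm]
  exact Finset.sum_congr rfl fun m hm => by rw [h1, h m hm]

/-- The amoeba of a simplex contains the points with positive balanced coordinates: the moduli of
the monomials close up to a polygon, and the monomials of a simplex take arbitrary values. -/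
theorem mem_simplexAmoeba {S : Finset Δ} {a : Δ → ℂˣ} (ha : ∀ m, ‖(a m : ℂ)‖ = 1)
    (hi : AffineIndependent ℝ (fun m : S => toPl ((m : Δ) : Lat))) {μ : Δ → ℝ}
    (hμ : μ ∈ faceWeights S) (hpos : ∀ m ∈ S, 0 < μ m) (hb : μ ∈ balanced Δ) :
    combo Δ μ ∈ simplexAmoeba a S := by
  have hsupp : ∀ f : ℝ → ℝ, f 0 = 0 → ∑ m ∈ S, f (μ m) = ∑ m, f (μ m) := fun f hf =>
    Finset.sum_subset (Finset.subset_univ S) fun m _ hm => by rw [hμ.2 m hm, hf]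
  obtain ⟨θ, hθ, hsum⟩ := exists_phases (card_le_three hi) (r := fun m => √(μ m))
    (fun m => Real.sqrt_nonneg _) fun m _ => by
      rw [hsupp Real.sqrt Real.sqrt_zero]
      exact hb m
  let z : Δ → ℂ := fun m => √(μ m) * θ m / a m
  have hz : ∀ m ∈ S, z m ≠ 0 := by
    intro m hm
    refine div_ne_zero (mul_ne_zero ?_ ?_) (a m).ne_zero
    · exact Complex.ofReal_ne_zero.2 (Real.sqrt_ne_zero'.2 (hpos m hm))
    · rw [← norm_ne_zero_iff, hθ]
      exact one_ne_zero
  have hnorm : ∀ m ∈ S, ‖z m‖ ^ 2 = μ m := by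
    intro m hm
    rw [norm_div, norm_mul, hθ, ha, mul_one, div_one, Complex.norm_real,
      Real.norm_of_nonneg (Real.sqrt_nonneg _), Real.sq_sqrt (hpos m hm).le]
  obtain ⟨g, c, hg⟩ := exists_affine_interpolation hi (fun m => Complex.log (z m))
  have hx : ∀ m ∈ S, monomial (expPoint (restrict g)) m = Complex.exp (-c) * z m := by
    intro m hm
    rw [monomial_expPoint]
    change Complex.exp (g (toPl (m : Lat))) = _
    rw [← Complex.exp_log (hz m hm), ← hg m hm, ← Complex.exp_add]
    congr 1
    ring
  refine ⟨expPoint (restrict g), ?_, ?_⟩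
  · change ∑ m ∈ S, (a m : ℂ) * monomial (expPoint (restrict g)) m = 0
    have : ∀ m ∈ S, (a m : ℂ) * monomial (expPoint (restrict g)) m =
        Complex.exp (-c) * (√(μ m) * θ m) := by
      intro m hm
      have := (a m).ne_zero
      rw [hx m hm]
      simp only [z]
      field_simp
    rw [Finset.sum_congr rfl this, ← Finset.mul_sum, hsum, mul_zero]
  · have hone : ∑ m ∈ S, μ m = 1 := (hsupp (fun t => t) rfl).trans hμ.1.2
    dsimp only
    rw [weightedMean_congr hx, weightedMean_mul _ _ _ (Complex.exp_ne_zero _), weightedMean,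
      Finset.sum_congr rfl hnorm, hone, combo_apply, ← Finset.sum_subset (Finset.subset_univ S)]
    · exact Finset.sum_congr rfl fun m hm => by rw [hnorm m hm, div_one]
    · intro m _ hm
      rw [hμ.2 m hm, zero_smul]

/-- In barycentric coordinates, the limit amoeba is given by the polygon inequalities. -/
theorem limitAmoeba_eq [Nonempty Δ] {w : Δ → ℝ} (hZ : IsSimplicial (subdivision w))
    {a : Δ → ℂˣ} (ha : ∀ m, ‖(a m : ℂ)‖ = 1) :
    limitAmoeba a (subdivision w) =
      combo Δ '' (complexWeights (subdivision w) ∩ balanced Δ) := by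
  apply Set.Subset.antisymm
  · refine Set.iUnion₂_subset fun S hS => ?_
    rintro _ ⟨x, hx, rfl⟩
    refine ⟨massWeights S (monomial x), ⟨mem_complexWeights.2 ⟨S, hS,
      massWeights_mem_faceWeights (sum_norm_monomial_ne_zero (mem_subdivision_iff.1 hS).1 x)⟩,
      massWeights_mem_balanced ha hx⟩, combo_massWeights _ _⟩
  · rintro _ ⟨μ, ⟨hμ, hb⟩, rfl⟩
    obtain ⟨S, hS, hμS, hpos⟩ := exists_cell_pos hZ hμ
    exact Set.mem_iUnion₂.2 ⟨S, hS, mem_simplexAmoeba ha (hZ S hS) hμS hpos hb⟩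

end SimplexAmoeba

/-! ### The graph in barycentric coordinates -/

section GraphCoordinates

variable {Δ : Finset Lat}

/-- The weights whose maximum is attained at least twice. -/
def tied (Δ : Finset Lat) : Set (Δ → ℝ) := {μ | ∃ i j, i ≠ j ∧ ∀ k, μ k ≤ μ i ∧ μ k ≤ μ j}

theorem uniformWeights_le {T : Finset Δ} {i : Δ} (hi : i ∈ T) (k : Δ) :
    uniformWeights T k ≤ uniformWeights T i := by
  classical
  unfold uniformWeights
  rw [if_pos hi]
  split_ifs <;> simp

/-- The weights on a simplex of the barycentric subdivision are maximal at the vertices of the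
smallest face of the chain. -/
theorem simplexGraph_subset (S : Finset Δ) :
    simplexGraph S ⊆ combo Δ '' (faceWeights S ∩ tied Δ) := by
  refine Set.iUnion₂_subset fun C hC => ?_
  obtain ⟨hchain, hC⟩ := hC
  rcases C.eq_empty_or_nonempty with rfl | hne
  · simp
  · obtain ⟨T, hT⟩ := (Set.toFinite C).exists_minimal hne
    have hmin : ∀ T' ∈ C, T ⊆ T' := fun T' hT' =>
      (hchain.total hT.1 hT').elim id fun h => hT.2 hT' h
    obtain ⟨i, hi, j, hj, hij⟩ := Finset.one_lt_card.1 (hC T hT.1).2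
    have hconv : Convex ℝ (faceWeights S ∩ {μ : Δ → ℝ | ∀ k, μ k ≤ μ i ∧ μ k ≤ μ j}) := by
      refine (convex_faceWeights S).inter fun μ hμ ν hν s t hs ht _ k => ?_
      simp only [Pi.add_apply, Pi.smul_apply, smul_eq_mul]
      have h1 := mul_le_mul_of_nonneg_left (hμ k).1 hs
      have h2 := mul_le_mul_of_nonneg_left (hμ k).2 hs
      have h3 := mul_le_mul_of_nonneg_left (hν k).1 ht
      have h4 := mul_le_mul_of_nonneg_left (hν k).2 ht
      exact ⟨add_le_add h1 h3, add_le_add h2 h4⟩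
    have hsub : convexHull ℝ (barycenter '' C) ⊆
        combo Δ '' (faceWeights S ∩ {μ : Δ → ℝ | ∀ k, μ k ≤ μ i ∧ μ k ≤ μ j}) := by
      refine convexHull_min ?_ (hconv.linear_image _)
      rintro _ ⟨T', hT', rfl⟩
      have hsub := hmin T' hT'
      exact ⟨uniformWeights T', ⟨uniformWeights_mem ⟨i, hsub hi⟩ (hC T' hT').1,
        fun k => ⟨uniformWeights_le (hsub hi) k, uniformWeights_le (hsub hj) k⟩⟩,
        combo_uniformWeights T'⟩
    exact hsub.trans (Set.image_mono (Set.inter_subset_inter_right _ fun μ hμ => ⟨i, j, hij, hμ⟩))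

/-- In a simplex of dimension at most two, the points with a tied maximum lie on the segment from
the midpoint of an edge to the barycenter. -/
theorem mem_simplexGraph {S : Finset Δ} (hS : S.card ≤ 3) {μ : Δ → ℝ} (hμ : μ ∈ faceWeights S)
    (hpos : ∀ m ∈ S, 0 < μ m) (ht : μ ∈ tied Δ) : combo Δ μ ∈ simplexGraph S := by
  classical
  obtain ⟨i, j, hij, hmax⟩ := ht
  have hS0 : S.Nonempty := by
    by_contra h
    rw [Finset.not_nonempty_iff_eq_empty] at h
    have h1 := hμ.1.2
    rw [Finset.sum_eq_zero fun m _ => hμ.2 m (by simp [h])] at h1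
    exact zero_ne_one h1
  obtain ⟨m₀, hm₀⟩ := hS0
  have hmem : ∀ k, 0 < μ k → k ∈ S := fun k hk => by
    by_contra h
    exact hk.ne' (hμ.2 k h)
  have hiS : i ∈ S := hmem i ((hpos m₀ hm₀).trans_le (hmax m₀).1)
  have hjS : j ∈ S := hmem j ((hpos m₀ hm₀).trans_le (hmax m₀).2)
  have heq : μ i = μ j := le_antisymm (hmax i).2 (hmax j).1
  have hsub : ({i, j} : Finset Δ) ⊆ S := by
    intro k hk
    rcases Finset.mem_insert.1 hk with rfl | hk
    · exact hiS
    · rwa [Finset.mem_singleton.1 hk]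
  have hcard : ({i, j} : Finset Δ).card = 2 := Finset.card_pair hij
  have hS2 : 2 ≤ S.card := hcard ▸ Finset.card_le_card hsub
  refine Set.mem_iUnion₂.2 ⟨{{i, j}, S}, ⟨?_, ?_⟩, ?_⟩
  · rintro A (rfl | rfl) B (rfl | rfl) hAB
    · exact absurd rfl hAB
    · exact Or.inl hsub
    · exact Or.inr hsub
    · exact absurd rfl hAB
  · rintro T (rfl | rfl)
    · exact ⟨hsub, hcard.ge⟩
    · exact ⟨le_rfl, hS2⟩
  · rw [Set.image_pair, convexHull_pair]
    have hS23 : S.card = 2 ∨ S.card = 3 := by omega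
    rcases hS23 with h2 | h3
    · have hSe : S = {i, j} := (Finset.eq_of_subset_of_card_le hsub (by omega)).symm
      have h1 := hμ.1.2
      rw [← Finset.sum_subset (Finset.subset_univ S) fun m _ hm => hμ.2 m hm, hSe,
        Finset.sum_pair hij] at h1
      have : μ = uniformWeights S := by
        funext k
        by_cases hk : k ∈ S
        · rw [uniformWeights, if_pos hk, h2]
          rw [hSe, Finset.mem_insert, Finset.mem_singleton] at hk
          rcases hk with rfl | rfl <;> norm_num <;> linarith
        · rw [uniformWeights, if_neg hk, hμ.2 k hk]
      rw [this, combo_uniformWeights]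
      exact right_mem_segment ℝ _ _
    · obtain ⟨k, hk⟩ : ∃ k, S \ {i, j} = {k} := by
        rw [← Finset.card_eq_one, Finset.card_sdiff_of_subset hsub]
        omega
      have hkS : k ∈ S ∧ k ∉ ({i, j} : Finset Δ) :=
        Finset.mem_sdiff.1 (hk ▸ Finset.mem_singleton_self k)
      have hSk : ∀ m ∈ S, m ∉ ({i, j} : Finset Δ) → m = k := fun m hm h =>
        Finset.mem_singleton.1 (hk ▸ Finset.mem_sdiff.2 ⟨hm, h⟩)
      have h1 := hμ.1.2
      rw [← Finset.sum_subset (Finset.subset_univ S) fun m _ hm => hμ.2 m hm,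
        ← Finset.sum_sdiff hsub, hk, Finset.sum_singleton, Finset.sum_pair hij] at h1
      have h0 := hpos k hkS.1
      have hle := (hmax k).1
      refine ⟨1 - 3 * μ k, 3 * μ k, by linarith, by linarith, by ring, ?_⟩
      rw [← combo_uniformWeights, ← combo_uniformWeights, ← map_smul, ← map_smul, ← map_add]
      congr 1
      funext m
      simp only [Pi.add_apply, Pi.smul_apply, smul_eq_mul, uniformWeights, hcard, h3]
      by_cases hmS : m ∈ S
      · rw [if_pos hmS]
        by_cases hm : m ∈ ({i, j} : Finset Δ)
        · rw [if_pos hm]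
          rw [Finset.mem_insert, Finset.mem_singleton] at hm
          rcases hm with rfl | rfl <;> norm_num <;> linarith
        · rw [if_neg hm, hSk m hmS hm]
          norm_num
          ring
      · rw [if_neg hmS, if_neg fun h => hmS (hsub h), hμ.2 m hmS]
        ring

/-- In barycentric coordinates, the graph is the set where the maximum is tied. -/
theorem graph_eq [Nonempty Δ] {w : Δ → ℝ} (hZ : IsSimplicial (subdivision w)) :
    graph (subdivision w) = combo Δ '' (complexWeights (subdivision w) ∩ tied Δ) := by
  apply Set.Subset.antisymm
  · refine Set.iUnion₂_subset fun S hS => (simplexGraph_subset S).trans (Set.image_mono ?_)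
    exact Set.inter_subset_inter_left _ fun μ hμ => mem_complexWeights.2 ⟨S, hS, hμ⟩
  · rintro _ ⟨μ, ⟨hμ, ht⟩, rfl⟩
    obtain ⟨S, hS, hμS, hpos⟩ := exists_cell_pos hZ hμ
    exact Set.mem_iUnion₂.2 ⟨S, hS, mem_simplexGraph (card_le_three (hZ S hS)) hμS hpos ht⟩

theorem balanced_of_tied {μ : Δ → ℝ} (ht : μ ∈ tied Δ) : μ ∈ balanced Δ := by
  classical
  obtain ⟨i, j, hij, hmax⟩ := ht
  intro k
  have hi := Real.sqrt_le_sqrt (hmax k).1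
  have hj := Real.sqrt_le_sqrt (hmax k).2
  have h : √(μ i) + √(μ j) ≤ ∑ k, √(μ k) := by
    rw [← Finset.sum_pair hij (f := fun k => √(μ k))]
    exact Finset.sum_le_sum_of_subset_of_nonneg (Finset.subset_univ _)
      fun m _ _ => Real.sqrt_nonneg _
  linarith

end GraphCoordinates

/-! ### The retraction onto the graph -/

section Retraction

variable {Δ : Finset Lat}

theorem offDiag_univ_nonempty [Nontrivial Δ] : (Finset.univ : Finset Δ).offDiag.Nonempty := by
  obtain ⟨i, j, hij⟩ := exists_pair_ne Δ
  exact ⟨(i, j), Finset.mem_offDiag.2 ⟨Finset.mem_univ i, Finset.mem_univ j, hij⟩⟩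

/-- The second largest weight, counted with multiplicity. -/
noncomputable def secondMax [Nontrivial Δ] (μ : Δ → ℝ) : ℝ :=
  (Finset.univ : Finset Δ).offDiag.sup'
    offDiag_univ_nonempty fun p => min (μ p.1) (μ p.2)

theorem continuous_secondMax [Nontrivial Δ] : Continuous (secondMax (Δ := Δ)) :=
  Continuous.finset_sup'_apply _ fun p _ =>
    (continuous_apply p.1).min (continuous_apply p.2)

theorem min_le_secondMax [Nontrivial Δ] (μ : Δ → ℝ) {i j : Δ} (h : i ≠ j) :
    min (μ i) (μ j) ≤ secondMax μ :=
  Finset.le_sup' (b := (i, j)) (fun p : Δ × Δ => min (μ p.1) (μ p.2))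
    (Finset.mem_offDiag.2 ⟨Finset.mem_univ i, Finset.mem_univ j, h⟩)

theorem exists_secondMax_eq [Nontrivial Δ] (μ : Δ → ℝ) :
    ∃ i j, i ≠ j ∧ secondMax μ = min (μ i) (μ j) := by
  obtain ⟨p, hp, h⟩ := Finset.exists_mem_eq_sup' offDiag_univ_nonempty
    fun p : Δ × Δ => min (μ p.1) (μ p.2)
  exact ⟨p.1, p.2, (Finset.mem_offDiag.1 hp).2.2, h⟩

/-- The weights capped at the second largest weight. -/
noncomputable def cap [Nontrivial Δ] (μ : Δ → ℝ) (m : Δ) : ℝ := min (μ m) (secondMax μ)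

theorem continuous_cap [Nontrivial Δ] (m : Δ) : Continuous fun μ : Δ → ℝ => cap μ m :=
  (continuous_apply m).min continuous_secondMax

theorem secondMax_pos [Nontrivial Δ] {μ : Δ → ℝ} (hμ : μ ∈ stdSimplex ℝ Δ)
    (hb : μ ∈ balanced Δ) : 0 < secondMax μ := by
  by_contra h
  have hle : ∀ i j, i ≠ j → 0 < μ i → μ j = 0 := by
    intro i j hij hi
    by_contra hj
    have hj' : 0 < μ j := lt_of_le_of_ne (hμ.1 j) (Ne.symm hj)
    exact h ((lt_min hi hj').trans_le (min_le_secondMax μ hij))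
  obtain ⟨i, hi⟩ : ∃ i, 0 < μ i := by
    by_contra hne
    simp only [not_exists, not_lt] at hne
    have h1 := Finset.sum_nonpos fun i (_ : i ∈ Finset.univ) => hne i
    rw [hμ.2] at h1
    linarith
  have h1 := hb i
  rw [Finset.sum_eq_single i (fun j _ hj => by rw [hle i j hj.symm hi, Real.sqrt_zero])
    (by simp)] at h1
  have := Real.sqrt_pos.2 hi
  linarith

theorem cap_nonneg [Nontrivial Δ] {μ : Δ → ℝ} (hμ : μ ∈ stdSimplex ℝ Δ) (m : Δ) :
    0 ≤ cap μ m := by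
  obtain ⟨i, j, -, h⟩ := exists_secondMax_eq μ
  exact le_min (hμ.1 m) (h ▸ le_min (hμ.1 i) (hμ.1 j))

theorem sum_cap_pos [Nontrivial Δ] {μ : Δ → ℝ} (hμ : μ ∈ stdSimplex ℝ Δ)
    (hb : μ ∈ balanced Δ) : 0 < ∑ m, cap μ m := by
  obtain ⟨i, j, -, h⟩ := exists_secondMax_eq μ
  have hs := secondMax_pos hμ hb
  refine Finset.sum_pos' (fun m _ => cap_nonneg hμ m) ⟨i, Finset.mem_univ i, lt_min ?_ hs⟩
  exact hs.trans_le (h ▸ min_le_left _ _)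

/-- The linear homotopy from `μ` to the normalization of the capped weights. -/
noncomputable def shrink [Nontrivial Δ] (t : ℝ) (μ : Δ → ℝ) (m : Δ) : ℝ :=
  (1 - t) * μ m + t * (cap μ m / ∑ k, cap μ k)

theorem shrink_mem_faceWeights [Nontrivial Δ] {t : ℝ} (ht : t ∈ Set.Icc (0 : ℝ) 1) {S : Finset Δ}
    {μ : Δ → ℝ} (hμ : μ ∈ faceWeights S) (hb : μ ∈ balanced Δ) :
    shrink t μ ∈ faceWeights S := by
  have hC := sum_cap_pos hμ.1 hb
  refine ⟨⟨fun m => ?_, ?_⟩, fun m hm => ?_⟩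
  · exact add_nonneg (mul_nonneg (by linarith [ht.2]) (hμ.1.1 m))
      (mul_nonneg ht.1 (div_nonneg (cap_nonneg hμ.1 m) hC.le))
  · simp only [shrink, Finset.sum_add_distrib, ← Finset.mul_sum, ← Finset.sum_div, hμ.1.2,
      div_self hC.ne']
    ring
  · have : cap μ m = 0 := by
      rw [cap, hμ.2 m hm]
      exact min_eq_left (secondMax_pos hμ.1 hb).le
    rw [shrink, hμ.2 m hm, this]
    simp

/-- Shrinking lowers, up to a common factor, at most the largest weight, and not below the second
largest one. This preserves the polygon inequalities. -/
theorem shrink_mem_balanced [Nontrivial Δ] {t : ℝ} (ht : t ∈ Set.Icc (0 : ℝ) 1)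
    {μ : Δ → ℝ} (hμ : μ ∈ stdSimplex ℝ Δ) (hb : μ ∈ balanced Δ) : shrink t μ ∈ balanced Δ := by
  classical
  have hC := sum_cap_pos hμ hb
  have h1t : 0 ≤ 1 - t := by linarith [ht.2]
  let κ : ℝ := 1 - t + t / ∑ k, cap μ k
  have hκ : 0 ≤ κ := add_nonneg h1t (div_nonneg ht.1 hC.le)
  have htC : 0 ≤ t / ∑ k, cap μ k := div_nonneg ht.1 hC.le
  have hcap : ∀ m, cap μ m ≤ μ m := fun m => min_le_left _ _
  have hup : ∀ m, shrink t μ m ≤ κ * μ m := fun m => by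
    have := mul_le_mul_of_nonneg_left (hcap m) htC
    have e : t * (cap μ m / ∑ k, cap μ k) = t / (∑ k, cap μ k) * cap μ m := by ring
    simp only [shrink, κ, e, add_mul]
    linarith
  have hlow : ∀ m, κ * cap μ m ≤ shrink t μ m := fun m => by
    have := mul_le_mul_of_nonneg_left (hcap m) h1t
    have e : t * (cap μ m / ∑ k, cap μ k) = t / (∑ k, cap μ k) * cap μ m := by ring
    simp only [shrink, κ, e, add_mul]
    linarith
  intro k
  have hsplit : ∀ ν : Δ → ℝ, ∑ m, √(ν m) = √(ν k) + ∑ m ∈ Finset.univ.erase k, √(ν m) :=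
    fun ν => (Finset.add_sum_erase _ _ (Finset.mem_univ k)).symm
  suffices h : √(shrink t μ k) ≤ ∑ m ∈ Finset.univ.erase k, √(shrink t μ m) by
    rw [hsplit]
    linarith
  by_cases hk : ∃ i, i ≠ k ∧ μ k ≤ μ i
  · obtain ⟨i, hik, hki⟩ := hk
    have h1 : μ k ≤ cap μ i := by
      refine le_min hki ?_
      have := min_le_secondMax μ hik
      rwa [min_eq_right hki] at this
    have h2 : shrink t μ k ≤ shrink t μ i :=
      (hup k).trans ((mul_le_mul_of_nonneg_left h1 hκ).trans (hlow i))
    exact (Real.sqrt_le_sqrt h2).trans (Finset.single_le_sum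
      (f := fun m => √(shrink t μ m)) (fun m _ => Real.sqrt_nonneg _)
      (Finset.mem_erase.2 ⟨hik, Finset.mem_univ i⟩))
  · simp only [not_exists, not_and, not_le] at hk
    have h1 : ∀ i ∈ Finset.univ.erase k, √(κ * μ i) ≤ √(shrink t μ i) := by
      intro i hi
      have hik := Finset.ne_of_mem_erase hi
      have h2 := min_le_secondMax μ hik
      rw [min_eq_left (hk i hik).le] at h2
      have h3 := hlow i
      rw [cap, min_eq_left h2] at h3
      exact Real.sqrt_le_sqrt h3
    have h2 := hb k
    rw [hsplit] at h2
    calc √(shrink t μ k) ≤ √(κ * μ k) := Real.sqrt_le_sqrt (hup k)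
      _ = √κ * √(μ k) := Real.sqrt_mul hκ _
      _ ≤ √κ * ∑ m ∈ Finset.univ.erase k, √(μ m) :=
        mul_le_mul_of_nonneg_left (by linarith) (Real.sqrt_nonneg _)
      _ = ∑ m ∈ Finset.univ.erase k, √(κ * μ m) := by
        rw [Finset.mul_sum]
        exact Finset.sum_congr rfl fun m _ => (Real.sqrt_mul hκ _).symm
      _ ≤ _ := Finset.sum_le_sum h1

theorem shrink_zero [Nontrivial Δ] (μ : Δ → ℝ) : shrink 0 μ = μ := by
  funext m
  simp [shrink]

theorem shrink_one_mem_tied [Nontrivial Δ] {μ : Δ → ℝ} (hμ : μ ∈ stdSimplex ℝ Δ)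
    (hb : μ ∈ balanced Δ) : shrink 1 μ ∈ tied Δ := by
  obtain ⟨i, j, hij, h⟩ := exists_secondMax_eq μ
  have hC := sum_cap_pos hμ hb
  have hi : cap μ i = secondMax μ := min_eq_right (h ▸ min_le_left _ _)
  have hj : cap μ j = secondMax μ := min_eq_right (h ▸ min_le_right _ _)
  have hle : ∀ k, cap μ k ≤ secondMax μ := fun k => min_le_right _ _
  refine ⟨i, j, hij, fun k => ?_⟩
  simp only [shrink, sub_self, zero_mul, one_mul, zero_add, hi, hj, and_self]
  exact div_le_div_of_nonneg_right (hle k) hC.le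

theorem shrink_of_tied [Nontrivial Δ] (t : ℝ) {μ : Δ → ℝ} (hμ : μ ∈ stdSimplex ℝ Δ)
    (h : μ ∈ tied Δ) : shrink t μ = μ := by
  obtain ⟨i, j, hij, hmax⟩ := h
  have hcap : cap μ = μ := by
    funext k
    exact min_eq_left ((le_min (hmax k).1 (hmax k).2).trans (min_le_secondMax μ hij))
  funext m
  rw [shrink, hcap, hμ.2]
  ring

theorem continuousOn_shrink [Nontrivial Δ] :
    ContinuousOn (fun p : ℝ × (Δ → ℝ) => shrink p.1 p.2)
      (Set.univ ×ˢ (stdSimplex ℝ Δ ∩ balanced Δ)) := by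
  rw [continuousOn_pi]
  intro m
  have hcap : ∀ k, Continuous fun p : ℝ × (Δ → ℝ) => cap p.2 k := fun k =>
    (continuous_cap k).comp continuous_snd
  refine ContinuousOn.add (by fun_prop) (ContinuousOn.mul (by fun_prop) ?_)
  exact (hcap m).continuousOn.div (continuous_finsetSum _ fun k _ => hcap k).continuousOn
    fun p hp => (sum_cap_pos hp.2.1 hp.2.2).ne'

end Retraction

/-! ### The limit amoeba is a fattening of the graph -/

section Fattening

variable {Δ : Finset Lat}

/-- Points with positive barycentric coordinates in a triangle are interior. -/
theorem combo_mem_interior {S : Finset Δ}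
    (hi : AffineIndependent ℝ (fun m : S => toPl ((m : Δ) : Lat))) (hS : S.card = 3) {μ : Δ → ℝ}
    (hμ : μ ∈ faceWeights S) (hpos : ∀ m ∈ S, 0 < μ m) :
    combo Δ μ ∈ interior (polygon Δ) := by
  let b : AffineBasis S ℝ Pl := ⟨fun m : S => toPl ((m : Δ) : Lat), hi,
    hi.affineSpan_eq_top_iff_card_eq_finrank_add_one.2 (by simp [hS])⟩
  have hrange : Set.range b = (fun m : Δ => toPl (m : Lat)) '' S := by
    ext x
    constructor
    · rintro ⟨m, rfl⟩
      exact ⟨m, m.2, rfl⟩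
    · rintro ⟨m, hm, rfl⟩
      exact ⟨⟨m, hm⟩, rfl⟩
  have hsub : convexHull ℝ (Set.range b) ⊆ polygon Δ := by
    rw [hrange]
    refine convexHull_mono ?_
    rintro _ ⟨m, -, rfl⟩
    exact ⟨m, m.2, rfl⟩
  refine interior_mono hsub ?_
  rw [AffineBasis.interior_convexHull]
  have hone : ∑ m : S, μ m = 1 := by
    rw [Finset.sum_coe_sort S μ, Finset.sum_subset (Finset.subset_univ S) fun m _ hm => hμ.2 m hm]
    exact hμ.1.2
  have hcombo : combo Δ μ = Finset.univ.affineCombination ℝ b fun m : S => μ m := by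
    rw [Finset.affineCombination_eq_linear_combination _ _ _ hone, combo_apply,
      ← Finset.sum_subset (Finset.subset_univ S) fun m _ hm => by rw [hμ.2 m hm, zero_smul]]
    exact (Finset.sum_coe_sort S fun m => μ m • toPl (m : Lat)).symm
  intro m
  rw [hcombo, b.coord_apply_combination_of_mem (Finset.mem_univ m) hone]
  exact hpos m m.2

/-- On at most two points, balanced weights are equal. -/
theorem tied_of_balanced {S : Finset Δ} (hS : S.card ≤ 2) {μ : Δ → ℝ} (hμ : μ ∈ faceWeights S)
    (hpos : ∀ m ∈ S, 0 < μ m) (hb : μ ∈ balanced Δ) : μ ∈ tied Δ := by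
  classical
  have hsum : ∑ m, √(μ m) = ∑ m ∈ S, √(μ m) :=
    (Finset.sum_subset (Finset.subset_univ S) fun m _ hm => by
      rw [hμ.2 m hm, Real.sqrt_zero]).symm
  obtain h0 | h1 | h2 : S.card = 0 ∨ S.card = 1 ∨ S.card = 2 := by omega
  · rw [Finset.card_eq_zero] at h0
    have h1 := hμ.1.2
    rw [Finset.sum_eq_zero fun m _ => hμ.2 m (by simp [h0])] at h1
    exact absurd h1 zero_ne_one
  · obtain ⟨p, rfl⟩ := Finset.card_eq_one.1 h1
    have h3 := hb p
    rw [hsum, Finset.sum_singleton] at h3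
    have h4 := Real.sqrt_pos.2 (hpos p (by simp))
    linarith
  · obtain ⟨p, q, hpq, rfl⟩ := Finset.card_eq_two.1 h2
    have h3 := hb p
    have h4 := hb q
    rw [hsum, Finset.sum_pair hpq] at h3 h4
    have hp := hpos p (by simp)
    have hq := hpos q (by simp)
    have h5 : μ p = μ q := (Real.sqrt_inj hp.le hq.le).1 (by linarith)
    refine ⟨p, q, hpq, fun k => ?_⟩
    rw [← h5, and_self]
    by_cases hk : k ∈ ({p, q} : Finset Δ)
    · rw [Finset.mem_insert, Finset.mem_singleton] at hk
      rcases hk with rfl | rfl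
      · exact le_rfl
      · exact h5.ge
    · rw [hμ.2 k hk]
      exact hp.le

theorem isFattening_limitAmoeba (hΔ : IsLatticePolygon Δ) {w : Δ → ℝ}
    (hZ : IsSimplicial (subdivision w)) {a : Δ → ℂˣ} (ha : ∀ m, ‖(a m : ℂ)‖ = 1) :
    IsFattening (polygon Δ) (limitAmoeba a (subdivision w)) (graph (subdivision w)) := by
  have := hΔ.nonempty
  have hinj := combo_injOn_complexWeights hZ
  have hpoly := combo_image_complexWeights hΔ hZ
  obtain ⟨x₀, hx₀⟩ := hΔ.2
  obtain ⟨S₀, hS₀, hc₀, -⟩ := exists_triangle hΔ hZ (interior_subset hx₀)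
  have : Nontrivial Δ := by
    obtain ⟨p, -, q, -, hpq⟩ := Finset.one_lt_card.1 (show 1 < S₀.card by omega)
    exact ⟨p, q, hpq⟩
  rw [limitAmoeba_eq hZ ha, graph_eq hZ]
  set W := complexWeights (subdivision w)
  have hWs : W ⊆ stdSimplex ℝ Δ := complexWeights_subset _
  have hsubset : combo Δ '' (W ∩ tied Δ) ⊆ combo Δ '' (W ∩ balanced Δ) :=
    Set.image_mono (Set.inter_subset_inter_right _ fun _ => balanced_of_tied)
  have hshrink : ∀ t ∈ Set.Icc (0 : ℝ) 1, ∀ μ ∈ W ∩ balanced Δ, shrink t μ ∈ W ∩ balanced Δ := by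
    rintro t ht μ ⟨hμ, hb⟩
    obtain ⟨S, hS, hμS⟩ := mem_complexWeights.1 hμ
    exact ⟨mem_complexWeights.2 ⟨S, hS, shrink_mem_faceWeights ht hμS hb⟩,
      shrink_mem_balanced ht hμS.1 hb⟩
  refine ⟨((isCompact_complexWeights _).inter_right isClosed_balanced).image continuous_combo,
    hpoly ▸ Set.image_mono Set.inter_subset_left, hsubset, ?_,
    fun p => combo Δ (shrink p.1 (coordinates (subdivision w) p.2)), ?_, ?_, ?_, ?_, ?_⟩
  · refine Set.Subset.antisymm ?_ (Set.inter_subset_inter_left _ hsubset)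
    rintro _ ⟨⟨μ, ⟨hμ, hb⟩, rfl⟩, hfr⟩
    obtain ⟨S, hS, hμS, hpos⟩ := exists_cell_pos hZ hμ
    refine ⟨⟨μ, ⟨hμ, ?_⟩, rfl⟩, hfr⟩
    have h3 := card_le_three (hZ S hS)
    by_cases hc : S.card = 3
    · exact absurd (combo_mem_interior (hZ S hS) hc hμS hpos) hfr.2
    · exact tied_of_balanced (by omega) hμS hpos hb
  · have hmaps : Set.MapsTo (fun p : ℝ × Pl => (p.1, coordinates (subdivision w) p.2))
        (Set.Icc (0 : ℝ) 1 ×ˢ (combo Δ '' (W ∩ balanced Δ)))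
        (Set.univ ×ˢ (stdSimplex ℝ Δ ∩ balanced Δ)) := by
      rintro ⟨t, _⟩ ⟨-, ⟨μ, hμ, rfl⟩⟩
      refine ⟨trivial, ?_⟩
      dsimp only
      rw [coordinates_combo hinj hμ.1]
      exact ⟨hWs hμ.1, hμ.2⟩
    refine continuous_combo.comp_continuousOn (continuousOn_shrink.comp ?_ hmaps)
    refine continuousOn_fst.prodMk ((continuousOn_coordinates hinj).comp continuousOn_snd ?_)
    rintro ⟨t, x⟩ ⟨-, hx⟩
    exact Set.image_mono Set.inter_subset_left hx
  · rintro t ht _ ⟨μ, hμ, rfl⟩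
    dsimp only
    rw [coordinates_combo hinj hμ.1]
    exact ⟨_, hshrink t ht μ hμ, rfl⟩
  · rintro _ ⟨μ, hμ, rfl⟩
    dsimp only
    rw [coordinates_combo hinj hμ.1, shrink_zero]
  · rintro _ ⟨μ, hμ, rfl⟩
    dsimp only
    rw [coordinates_combo hinj hμ.1]
    exact ⟨_, ⟨(hshrink 1 (Set.right_mem_Icc.2 zero_le_one) μ hμ).1,
      shrink_one_mem_tied (hWs hμ.1) hμ.2⟩, rfl⟩
  · rintro t - _ ⟨μ, hμ, rfl⟩
    dsimp only
    rw [coordinates_combo hinj hμ.1, shrink_of_tied t (hWs hμ.1) hμ.2]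

end Fattening

/-! ### The amoebas accumulate only at the limit amoeba -/

section UpperLimit

variable {Δ : Finset Lat}

/-- A set `T` that lies in no cell is lifted, on average, strictly above the cell that contains its
barycenter; this is witnessed by an integral relation. -/
theorem exists_lifted_relation (hΔ : IsLatticePolygon Δ) {w : Δ → ℤ}
    (hZ : IsSimplicial (subdivision fun m => (w m : ℝ))) {T : Finset Δ}
    (hT : ∀ S ∈ subdivision (fun m => (w m : ℝ)), ¬ T ⊆ S) :
    ∃ N : ℕ, 0 < N ∧ ∃ k : Δ → ℕ, ∑ m, k m = N * T.card ∧
      ∑ m, k m • (m : Lat) = N • ∑ m ∈ T, (m : Lat) ∧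
      ∑ m, (k m : ℤ) * w m < N * ∑ m ∈ T, w m := by
  classical
  have := hΔ.nonempty
  have hne : T.Nonempty := by
    by_contra h
    rw [Finset.not_nonempty_iff_eq_empty] at h
    obtain ⟨x, hx⟩ := hΔ.2
    obtain ⟨S, hS, -⟩ := exists_triangle hΔ hZ (interior_subset hx)
    exact hT S hS (h ▸ Finset.empty_subset S)
  have hμ := uniformWeights_mem hne (subset_refl T)
  obtain ⟨S, hS, hc, ν, hν, hνμ⟩ := exists_triangle hΔ hZ
    (polygon_eq (Δ := Δ) ▸ ⟨_, hμ.1, rfl⟩ : combo Δ (uniformWeights T) ∈ polygon Δ)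
  obtain ⟨N, hN, h⟩ := exists_integral_coordinates (hZ S hS) hc
  choose c hc0 hc1 hc2 using h
  lift N to ℕ using hN.le
  have hN' : (0 : ℝ) < N := by exact_mod_cast hN
  have hT0 : (0 : ℝ) < T.card := by exact_mod_cast hne.card_pos
  -- the coordinates of the barycenter of `T`, multiplied by `N * T.card` to become integral
  let k : Δ → ℤ := fun s => ∑ m ∈ T, c (m : Lat) s
  have hk1 : ∑ s, k s = N * T.card := by
    simp only [k]
    rw [Finset.sum_comm]
    simp only [hc1]
    rw [Finset.sum_const, nsmul_eq_mul, mul_comm]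
  have hk2 : ∑ s, k s • (s : Lat) = (N : ℤ) • ∑ m ∈ T, (m : Lat) := by
    simp only [k, Finset.sum_smul]
    rw [Finset.sum_comm]
    simp only [hc2]
    rw [Finset.smul_sum]
  have hkν : (fun s => (k s : ℝ)) = (N * T.card : ℝ) • ν := by
    refine eq_of_combo_eq (hZ S hS) (fun m hm => ?_) (fun m hm => ?_) ?_ ?_
    · simp only [k]
      rw [Finset.sum_eq_zero fun m' _ => hc0 _ m hm, Int.cast_zero]
    · rw [Pi.smul_apply, hν.2 m hm, smul_zero]
    · simp only [Pi.smul_apply, smul_eq_mul, ← Finset.mul_sum, hν.1.2, mul_one]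
      exact_mod_cast hk1
    · rw [map_smul, hνμ, combo_uniformWeights, barycenter, smul_smul, mul_assoc,
        mul_inv_cancel₀ hT0.ne', mul_one, combo_apply]
      ext i
      have h1 := congrFun hk2 i
      simp only [Finset.sum_apply, Pi.smul_apply, smul_eq_mul, toPl] at h1 ⊢
      exact_mod_cast h1
  have hkn : ∀ s, 0 ≤ k s := fun s => by
    have h1 : (k s : ℝ) = N * T.card * ν s := congrFun hkν s
    have h2 : (0 : ℝ) ≤ k s := h1 ▸ mul_nonneg (by positivity) (hν.1.1 s)
    exact_mod_cast h2
  have hlt : ∑ m, ν m * (w m : ℝ) < ∑ m, uniformWeights T m * (w m : ℝ) := by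
    obtain ⟨-, h2⟩ := faceWeights_of_combo_eq hS hμ.1 hν hνμ.symm
    by_contra hle
    have h3 := h2 (not_lt.1 hle)
    refine hT S hS fun m hm => ?_
    by_contra hmS
    have h4 := h3.2 m hmS
    rw [uniformWeights, if_pos hm] at h4
    exact inv_ne_zero hT0.ne' h4
  refine ⟨N, by exact_mod_cast hN, fun s => (k s).toNat, ?_, ?_, ?_⟩
  · zify
    simp only [Int.toNat_of_nonneg (hkn _)]
    exact hk1
  · rw [← natCast_zsmul (∑ m ∈ T, (m : Lat)), ← hk2]
    exact Finset.sum_congr rfl fun s _ => by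
      rw [← natCast_zsmul, Int.toNat_of_nonneg (hkn s)]
  · simp only [Int.toNat_of_nonneg (hkn _)]
    have h1 : ∑ m, (k m : ℝ) * w m = N * T.card * ∑ m, ν m * w m := by
      rw [Finset.mul_sum]
      exact Finset.sum_congr rfl fun m _ => by
        rw [show (k m : ℝ) = N * T.card * ν m from congrFun hkν m, mul_assoc]
    have h2 : (N : ℝ) * ∑ m ∈ T, (w m : ℝ) =
        N * T.card * ∑ m, uniformWeights T m * w m := by
      simp only [uniformWeights, ite_mul, zero_mul]
      rw [Finset.sum_ite_mem, Finset.univ_inter, ← Finset.mul_sum, mul_assoc, ← mul_assoc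
        (T.card : ℝ), mul_inv_cancel₀ hT0.ne', one_mul]
    have h3 : ∑ m, (k m : ℝ) * w m < N * ∑ m ∈ T, (w m : ℝ) := by
      rw [h1, h2]
      exact mul_lt_mul_of_pos_left hlt (by positivity)
    exact_mod_cast h3

theorem prod_sectionValue_pow (p : Σ v : Vertex Δ, Chart (normalCone Δ v)) (k : Δ → ℕ) :
    ∏ m, sectionValue Δ p m ^ k m =
      p.2 (∑ m, k m • (⟨(m : Lat) - (p.1.1 : Lat), sub_mem_dual Δ p.1 m⟩ :
        dualMonoid (normalCone Δ p.1))) := by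
  classical
  have key : ∀ (s : Finset Δ) (f : Δ → dualMonoid (normalCone Δ p.1)),
      p.2 (∑ m ∈ s, f m) = ∏ m ∈ s, p.2 (f m) := by
    intro s f
    induction s using Finset.induction_on with
    | empty => simp
    | insert i s hi ih =>
      rw [Finset.sum_insert hi, Finset.prod_insert hi, AddChar.map_add_eq_mul, ih]
  rw [key]
  exact Finset.prod_congr rfl fun m _ => (AddChar.map_nsmul_eq_pow _ _ _).symm

/-- The sections satisfy the binomial equations given by the relations between lattice points. -/
theorem prod_sectionValue_eq (p : Σ v : Vertex Δ, Chart (normalCone Δ v)) {k l : Δ → ℕ}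
    (h1 : ∑ m, k m = ∑ m, l m) (h2 : ∑ m, k m • (m : Lat) = ∑ m, l m • (m : Lat)) :
    ∏ m, sectionValue Δ p m ^ k m = ∏ m, sectionValue Δ p m ^ l m := by
  rw [prod_sectionValue_pow, prod_sectionValue_pow]
  congr 1
  apply Subtype.ext
  simp only [AddSubmonoid.coe_finsetSum, AddSubmonoidClass.coe_nsmul, smul_sub,
    Finset.sum_sub_distrib, ← Finset.sum_smul, h1, h2]

/-- The binomial equation of a lifted relation forces the weights on `T` to be small. -/
theorem prod_massWeights_le {δ : ℝ} (hδ : 0 < δ) (hδ1 : δ ≤ 1) {w : Δ → ℤ}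
    (p : Σ v : Vertex Δ, Chart (normalCone Δ v)) {T : Finset Δ} {N : ℕ} {k : Δ → ℕ}
    (h1 : ∑ m, k m = N * T.card) (h2 : ∑ m, k m • (m : Lat) = N • ∑ m ∈ T, (m : Lat))
    (h3 : ∑ m, (k m : ℤ) * w m < N * ∑ m ∈ T, w m) :
    (∏ m ∈ T, massWeights Finset.univ (fun m => (δ : ℂ) ^ w m * sectionValue Δ p m) m) ^ N ≤ δ := by
  classical
  set Y : Δ → ℂ := fun m => (δ : ℂ) ^ w m * sectionValue Δ p m with hY
  set c : ℝ := (∑ m, ‖Y m‖ ^ 2)⁻¹ with hc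
  have hρ : ∀ m, massWeights Finset.univ Y m = c * ‖Y m‖ ^ 2 := fun m => by
    rw [massWeights, if_pos (Finset.mem_univ m), div_eq_inv_mul]
  have hnorm : ∀ m, ‖Y m‖ = δ ^ w m * ‖sectionValue Δ p m‖ := fun m => by
    rw [hY, norm_mul, norm_zpow, Complex.norm_real, Real.norm_of_nonneg hδ.le]
  -- the exponents of the other side of the relation
  let l : Δ → ℕ := fun m => if m ∈ T then N else 0
  have hl : ∀ f : Δ → ℝ, ∏ m, f m ^ l m = (∏ m ∈ T, f m) ^ N := by
    intro f
    rw [← Finset.prod_pow, ← Finset.prod_subset (Finset.subset_univ T)]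
    · exact Finset.prod_congr rfl fun m hm => by simp only [l, if_pos hm]
    · intro m _ hm
      simp only [l, if_neg hm, pow_zero]
  have hl1 : ∑ m, l m = N * T.card := by
    simp only [l]
    rw [Finset.sum_ite_mem, Finset.univ_inter, Finset.sum_const, smul_eq_mul, mul_comm]
  have hl2 : ∑ m, l m • (m : Lat) = N • ∑ m ∈ T, (m : Lat) := by
    simp only [l, ite_smul, zero_smul]
    rw [Finset.sum_ite_mem, Finset.univ_inter, Finset.smul_sum]
  have hl3 : ∑ m, (l m : ℤ) * w m = N * ∑ m ∈ T, w m := by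
    simp only [l, Nat.cast_ite, ite_mul, Nat.cast_zero, zero_mul]
    rw [Finset.sum_ite_mem, Finset.univ_inter, Finset.mul_sum]
  have hbin : ∏ m, ‖sectionValue Δ p m‖ ^ l m = ∏ m, ‖sectionValue Δ p m‖ ^ k m := by
    have := congrArg norm (prod_sectionValue_eq p (hl1.trans h1.symm) (hl2.trans h2.symm))
    simpa only [norm_prod, norm_pow] using this
  have hprod : ∀ q : Δ → ℕ, ∏ m, ‖Y m‖ ^ q m =
      δ ^ (∑ m, (q m : ℤ) * w m) * ∏ m, ‖sectionValue Δ p m‖ ^ q m := by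
    intro q
    rw [zpow_sum₀ _ hδ.ne', ← Finset.prod_mul_distrib]
    refine Finset.prod_congr rfl fun m _ => ?_
    rw [hnorm, mul_pow, mul_comm (q m : ℤ), zpow_mul, zpow_natCast]
  have hmass : ∀ q : Δ → ℕ, ∏ m, massWeights Finset.univ Y m ^ q m =
      c ^ (∑ m, q m) * (∏ m, ‖Y m‖ ^ q m) ^ 2 := by
    intro q
    rw [← Finset.prod_pow_eq_pow_sum, ← Finset.prod_pow, ← Finset.prod_mul_distrib]
    refine Finset.prod_congr rfl fun m _ => ?_
    rw [hρ, mul_pow, ← pow_mul, ← pow_mul, mul_comm 2]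
  set D : ℤ := N * ∑ m ∈ T, w m - ∑ m, (k m : ℤ) * w m with hD
  have hkey : ∏ m, massWeights Finset.univ Y m ^ l m =
      (δ ^ D) ^ 2 * ∏ m, massWeights Finset.univ Y m ^ k m := by
    rw [hmass, hmass, hprod, hprod, hbin, hl3, hl1, h1,
      show (N : ℤ) * ∑ m ∈ T, w m = D + ∑ m, (k m : ℤ) * w m by rw [hD]; ring,
      zpow_add₀ hδ.ne']
    ring
  have hc0 : 0 ≤ c := inv_nonneg.2 (Finset.sum_nonneg fun m _ => by positivity)
  have hle : ∏ m, massWeights Finset.univ Y m ^ k m ≤ 1 := by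
    refine Finset.prod_le_one (fun m _ => ?_) fun m _ => pow_le_one₀ ?_ ?_
    · rw [hρ]
      positivity
    · rw [hρ]
      positivity
    · rw [massWeights, if_pos (Finset.mem_univ m)]
      exact div_le_one_of_le₀ (Finset.single_le_sum (f := fun m => ‖Y m‖ ^ 2)
        (fun m _ => by positivity) (Finset.mem_univ m)) (Finset.sum_nonneg fun m _ => by positivity)
  rw [← hl, hkey]
  have hDδ : δ ^ D ≤ δ := by
    have h := zpow_le_zpow_right_of_le_one₀ hδ hδ1 (show (1 : ℤ) ≤ D by omega)
    rwa [zpow_one] at h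
  have h0 : 0 ≤ δ ^ D := (zpow_pos hδ D).le
  calc (δ ^ D) ^ 2 * _ ≤ (δ ^ D) ^ 2 * 1 := mul_le_mul_of_nonneg_left hle (by positivity)
    _ = δ ^ D * δ ^ D := by ring
    _ ≤ δ * 1 := mul_le_mul hDδ (hDδ.trans hδ1) h0 hδ.le
    _ = δ := mul_one δ

/-- In the coordinates of `massWeights`, the amoeba lies in the set of balanced weights that almost
vanish somewhere on each set `T` contained in no cell. -/
theorem amoeba_subset {a : Δ → ℂˣ} (ha : ∀ m, ‖(a m : ℂ)‖ = 1) (w : Δ → ℤ) (δ : Set.Ioi (0 : ℝ))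
    (hδ1 : (δ : ℝ) ≤ 1) : amoeba Δ a w δ ⊆ combo Δ '' {μ | μ ∈ stdSimplex ℝ Δ ∧ μ ∈ balanced Δ ∧
      ∀ (T : Finset Δ) (N : ℕ) (k : Δ → ℕ), ∑ m, k m = N * T.card →
        ∑ m, k m • (m : Lat) = N • ∑ m ∈ T, (m : Lat) →
        ∑ m, (k m : ℤ) * w m < N * ∑ m ∈ T, w m → (∏ m ∈ T, μ m) ^ N ≤ δ} := by
  have hδ : (0 : ℝ) < δ := δ.2
  rintro _ ⟨⟨p⟩, hx, rfl⟩
  let Y : Δ → ℂ := fun m => ((δ : ℝ) : ℂ) ^ w m * sectionValue Δ p m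
  have hx' : ∑ m, (a m : ℂ) * Y m = 0 := by
    have h : ∑ m, (scaled a w δ m : ℂ) * sectionValue Δ p m = 0 := hx
    rw [← h]
    refine Finset.sum_congr rfl fun m _ => ?_
    rw [scaled, Units.val_mul, Units.val_zpow_eq_zpow_val, Units.val_mk0]
    ring
  have hY : ∑ m, ‖Y m‖ ^ 2 ≠ 0 := by
    have hv : sectionValue Δ p p.1.1 = 1 := by
      have : (⟨(p.1.1 : Lat) - (p.1.1 : Lat), sub_mem_dual Δ p.1 p.1.1⟩ :
          dualMonoid (normalCone Δ p.1)) = 0 := Subtype.ext (sub_self _)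
      rw [sectionValue, this, AddChar.map_zero_eq_one]
    refine (Finset.sum_pos' (fun m _ => by positivity) ⟨p.1.1, Finset.mem_univ _, ?_⟩).ne'
    simp only [Y, hv, mul_one]
    exact pow_pos (norm_pos_iff.2 (zpow_ne_zero _ (Complex.ofReal_ne_zero.2 hδ.ne'))) 2
  exact ⟨massWeights Finset.univ Y, ⟨(massWeights_mem_faceWeights hY).1,
    massWeights_mem_balanced ha hx', fun T N k h1 h2 h3 => prod_massWeights_le hδ hδ1 p h1 h2 h3⟩,
    combo_massWeights _ _⟩

/-- Every neighborhood of the limit amoeba eventually contains the amoebas. -/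
theorem eventually_amoeba_subset (hΔ : IsLatticePolygon Δ) {w : Δ → ℤ}
    (hZ : IsSimplicial (subdivision fun m => (w m : ℝ))) {a : Δ → ℂˣ}
    (ha : ∀ m, ‖(a m : ℂ)‖ = 1) {U : Set Pl} (hU : IsOpen U)
    (hsub : limitAmoeba a (subdivision fun m => (w m : ℝ)) ⊆ U) :
    ∀ᶠ δ in comap ((↑) : Set.Ioi (0 : ℝ) → ℝ) (𝓝 0), amoeba Δ a w δ ⊆ U := by
  classical
  have := hΔ.nonempty
  rw [limitAmoeba_eq hZ ha] at hsub
  let B : Finset (Finset Δ) :=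
    Finset.univ.filter fun T => ∀ S ∈ subdivision (fun m => (w m : ℝ)), ¬ T ⊆ S
  have hB : ∀ T, T ∈ B ↔ ∀ S ∈ subdivision (fun m => (w m : ℝ)), ¬ T ⊆ S := fun T => by simp [B]
  let φ : (Δ → ℝ) → ℝ := fun μ => ∑ T ∈ B, ∏ m ∈ T, μ m
  have hφ : Continuous φ := by fun_prop
  have hC : IsCompact ((stdSimplex ℝ Δ ∩ balanced Δ) \ (combo Δ ⁻¹' U)) :=
    ((isCompact_stdSimplex ℝ Δ).inter_right isClosed_balanced).diff (hU.preimage continuous_combo)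
  have hpos : ∀ μ ∈ (stdSimplex ℝ Δ ∩ balanced Δ) \ (combo Δ ⁻¹' U), 0 < φ μ := by
    rintro μ ⟨⟨h1, h2⟩, h3⟩
    have hterm : ∀ T ∈ B, 0 ≤ ∏ m ∈ T, μ m := fun T _ => Finset.prod_nonneg fun m _ => h1.1 m
    -- otherwise the support of `μ` lies in a cell
    by_contra hle
    have h0 := (Finset.sum_eq_zero_iff_of_nonneg hterm).1
      (le_antisymm (not_lt.1 hle) (Finset.sum_nonneg hterm))
    have hsupp : Finset.univ.filter (fun m => μ m ≠ 0) ∉ B := fun h => by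
      obtain ⟨m, hm, hm0⟩ := Finset.prod_eq_zero_iff.1 (h0 _ h)
      exact (Finset.mem_filter.1 hm).2 hm0
    rw [hB] at hsupp
    push Not at hsupp
    obtain ⟨S, hS, hST⟩ := hsupp
    refine h3 (hsub ⟨μ, ⟨mem_complexWeights.2 ⟨S, hS, h1, fun m hm => ?_⟩, h2⟩, rfl⟩)
    by_contra hne
    exact hm (hST (Finset.mem_filter.2 ⟨Finset.mem_univ m, hne⟩))
  obtain ⟨η, hη, hηφ⟩ : ∃ η : ℝ, 0 < η ∧
      ∀ μ ∈ (stdSimplex ℝ Δ ∩ balanced Δ) \ (combo Δ ⁻¹' U), η ≤ φ μ := by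
    rcases ((stdSimplex ℝ Δ ∩ balanced Δ) \ (combo Δ ⁻¹' U)).eq_empty_or_nonempty with he | hne
    · exact ⟨1, one_pos, by simp [he]⟩
    · obtain ⟨μ₀, h0, hmin⟩ := hC.exists_isMinOn hne hφ.continuousOn
      exact ⟨φ μ₀, hpos μ₀ h0, fun μ hμ => hmin hμ⟩
  -- if each of the `B.card` summands of `φ` is at most `ε`, then `φ` is below `η`
  let ε : ℝ := η / (B.card + 1)
  have hε : 0 < ε := by positivity
  have hrel : ∀ T : B, ∃ N : ℕ, 0 < N ∧ ∃ k : Δ → ℕ, ∑ m, k m = N * T.1.card ∧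
      ∑ m, k m • (m : Lat) = N • ∑ m ∈ T.1, (m : Lat) ∧
      ∑ m, (k m : ℤ) * w m < N * ∑ m ∈ T.1, w m := fun T =>
    exists_lifted_relation hΔ hZ ((hB T.1).1 T.2)
  choose N hN k hk1 hk2 hk3 using hrel
  have hsmall : ∀ᶠ δ : Set.Ioi (0 : ℝ) in comap (↑) (𝓝 (0 : ℝ)),
      (δ : ℝ) < 1 ∧ ∀ T : B, (δ : ℝ) < ε ^ N T :=
    (tendsto_comap.eventually (gt_mem_nhds one_pos)).and
      (eventually_all.2 fun T => tendsto_comap.eventually (gt_mem_nhds (pow_pos hε _)))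
  filter_upwards [hsmall] with δ hδ x hx
  obtain ⟨μ, ⟨h1, h2, h3⟩, rfl⟩ := amoeba_subset ha w δ hδ.1.le hx
  by_contra hxU
  have h4 := hηφ μ ⟨⟨h1, h2⟩, hxU⟩
  have h5 : φ μ ≤ ∑ T ∈ B, ε := by
    refine Finset.sum_le_sum fun T hT => ?_
    have h6 := (h3 T _ _ (hk1 ⟨T, hT⟩) (hk2 ⟨T, hT⟩) (hk3 ⟨T, hT⟩)).trans (hδ.2 ⟨T, hT⟩).le
    exact le_of_pow_le_pow_left₀ (hN ⟨T, hT⟩).ne' hε.le h6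
  rw [Finset.sum_const, nsmul_eq_mul] at h5
  have h7 : (B.card + 1 : ℝ) * ε = η := mul_div_cancel₀ η (by positivity)
  linarith

end UpperLimit

/-! ### Every point of the limit amoeba is a limit of amoeba points -/

section LowerLimit

variable {Δ : Finset Lat}

theorem IsLatticePolygon.nonempty_vertex (hΔ : IsLatticePolygon Δ) : Nonempty (Vertex Δ) := by
  obtain ⟨x, hx⟩ := (isCompact_polygon (Δ := Δ)).extremePoints_nonempty
    (hΔ.2.mono interior_subset)
  obtain ⟨m, hm, rfl⟩ := extremePoints_convexHull_subset hx
  exact ⟨⟨⟨m, hm⟩, hx⟩⟩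

/-- The torus points of the curve map to the amoeba. -/
theorem mem_amoeba_of_torus (hΔ : IsLatticePolygon Δ) {a : Δ → ℂˣ} {w : Δ → ℤ}
    {δ : Set.Ioi (0 : ℝ)} {y : Torus Lat}
    (h : ∑ m, (a m : ℂ) * (((δ : ℝ) : ℂ) ^ w m * monomial y m) = 0) :
    weightedMean Finset.univ (fun m => ((δ : ℝ) : ℂ) ^ w m * monomial y m) ∈ amoeba Δ a w δ := by
  obtain ⟨v⟩ := hΔ.nonempty_vertex
  let p : Σ v : Vertex Δ, Chart (normalCone Δ v) := ⟨v, Chart.ofTorus (normalCone Δ v) y⟩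
  have hs : ∀ m, sectionValue Δ p m = (monomial y v.1)⁻¹ * monomial y m := by
    intro m
    change ((y ((m : Lat) - (v.1 : Lat)) : ℂˣ) : ℂ) = _
    rw [AddChar.map_sub_eq_div, Units.val_div_eq_div_val, div_eq_inv_mul]
    rfl
  refine ⟨ToricVariety.mk (normalCone Δ) v (Chart.ofTorus (normalCone Δ v) y), ?_, ?_⟩
  · change ∑ m, (scaled a w δ m : ℂ) * sectionValue Δ p m = 0
    rw [← mul_zero (monomial y v.1)⁻¹, ← h, Finset.mul_sum]
    refine Finset.sum_congr rfl fun m _ => ?_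
    rw [hs, scaled, Units.val_mul, Units.val_zpow_eq_zpow_val, Units.val_mk0]
    ring
  · change weightedMean Finset.univ (fun m => ((δ : ℝ) : ℂ) ^ w m * sectionValue Δ p m) = _
    rw [← weightedMean_mul Finset.univ (fun m => ((δ : ℝ) : ℂ) ^ w m * monomial y m) _
      (inv_ne_zero (monomial_ne_zero y v.1))]
    refine weightedMean_congr fun m _ => ?_
    rw [hs]
    ring

/-- Zeros of `∑ s_m b_m e^{t ξ_m}` that are simple in `t` persist under small changes of the
coefficients `s`. -/
theorem eventually_exists_zero {ι : Type*} [Fintype ι] (b ξ s₀ : ι → ℂ)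
    (h0 : ∑ m, s₀ m * b m = 0) (h1 : ∑ m, s₀ m * b m * ξ m ≠ 0) {P : ℂ × (ι → ℂ) → Prop}
    (hP : ∀ᶠ p in 𝓝 ((0 : ℂ), s₀), P p) :
    ∀ᶠ s in 𝓝 s₀, ∃ t : ℂ, ∑ m, s m * b m * Complex.exp (t * ξ m) = 0 ∧ P (t, s) := by
  let F : ℂ × (ι → ℂ) → ℂ := fun p => ∑ m, p.2 m * b m * Complex.exp (p.1 * ξ m)
  have hF : ContDiff ℂ 1 F := by
    refine ContDiff.sum fun m _ => ?_
    fun_prop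
  have hF' : HasStrictFDerivAt F (fderiv ℂ F (0, s₀)) (0, s₀) :=
    hF.contDiffAt.hasStrictFDerivAt one_ne_zero
  set L := fderiv ℂ F (0, s₀)
  have hL : L (1, 0) = ∑ m, s₀ m * b m * ξ m := by
    have h2 : HasDerivAt (fun t : ℂ => F (t, s₀)) (L (1, 0)) 0 :=
      HasFDerivAt.comp_hasDerivAt (f := fun t : ℂ => (t, s₀)) (0 : ℂ) hF'.hasFDerivAt
        ((hasDerivAt_id (0 : ℂ)).prodMk (hasDerivAt_const (0 : ℂ) s₀))
    have h3 : HasDerivAt (fun t : ℂ => F (t, s₀)) (∑ m, s₀ m * b m * ξ m) 0 := by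
      refine HasDerivAt.fun_sum fun m _ => ?_
      have h4 : HasDerivAt (fun t : ℂ => t * ξ m) (ξ m) 0 := by
        simpa using (hasDerivAt_id (0 : ℂ)).mul_const (ξ m)
      simpa using h4.cexp.const_mul (s₀ m * b m)
    exact h2.unique h3
  -- the map `(t, s) ↦ (F (t, s), s)` is open at `(0, s₀)`
  have hΦ : HasStrictFDerivAt (fun p : ℂ × (ι → ℂ) => (F p, p.2))
      (L.prod (ContinuousLinearMap.snd ℂ ℂ (ι → ℂ))) (0, s₀) := hF'.prodMk hasStrictFDerivAt_snd
  have hsurj : (L.prod (ContinuousLinearMap.snd ℂ ℂ (ι → ℂ))).range = ⊤ := by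
    rw [LinearMap.range_eq_top]
    rintro ⟨y, σ⟩
    refine ⟨((y - L (0, σ)) / L (1, 0), σ), Prod.ext ?_ rfl⟩
    have h5 : (((y - L (0, σ)) / L (1, 0), σ) : ℂ × (ι → ℂ)) =
        ((y - L (0, σ)) / L (1, 0)) • ((1, 0) : ℂ × (ι → ℂ)) + (0, σ) := by simp
    change L (_, _) = y
    rw [h5, map_add, map_smul, smul_eq_mul, div_mul_cancel₀ _ (hL ▸ h1), sub_add_cancel]
  have hmap := hΦ.map_nhds_eq_of_surj hsurj
  have hF0 : F (0, s₀) = 0 := by simpa [F] using h0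
  dsimp only at hmap
  rw [hF0] at hmap
  have hmem : (fun p : ℂ × (ι → ℂ) => (F p, p.2)) '' {p | P p} ∈ 𝓝 ((0 : ℂ), s₀) := by
    rw [← hmap]
    exact image_mem_map hP
  have hcont : Tendsto (fun s : ι → ℂ => ((0 : ℂ), s)) (𝓝 s₀) (𝓝 (0, s₀)) :=
    (Continuous.prodMk_right (0 : ℂ)).tendsto s₀
  filter_upwards [hcont hmem] with s hs
  obtain ⟨⟨t, s'⟩, hp, heq⟩ := hs
  obtain ⟨h6, rfl⟩ := Prod.mk.inj heq
  exact ⟨t, h6, hp⟩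

theorem continuousAt_weightedMean {X : Type*} [TopologicalSpace X] {S : Finset Δ}
    {f : X → Δ → ℂ} {x : X} (hf : ∀ m, ContinuousAt (fun y => f y m) x)
    (h : ∑ m ∈ S, ‖f x m‖ ^ 2 ≠ 0) : ContinuousAt (fun y => weightedMean S (f y)) x := by
  unfold weightedMean
  refine tendsto_finsetSum _ fun m _ => ?_
  refine ContinuousAt.smul (ContinuousAt.div ((hf m).norm.pow 2) ?_ h) continuousAt_const
  exact tendsto_finsetSum _ fun k _ => (hf k).norm.pow 2

/-- The powers `δ^d` of exponent `d > 0` tend to zero with `δ`. -/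
theorem tendsto_exp_log_mul {d : ℝ} (hd : 0 < d) :
    Tendsto (fun δ : Set.Ioi (0 : ℝ) => Complex.exp ((Real.log δ : ℂ) * (d : ℂ)))
      (comap (↑) (𝓝 (0 : ℝ))) (𝓝 0) := by
  have h1 : Tendsto (fun δ : Set.Ioi (0 : ℝ) => (δ : ℝ)) (comap (↑) (𝓝 (0 : ℝ))) (𝓝[>] 0) :=
    tendsto_nhdsWithin_iff.2 ⟨tendsto_comap, Eventually.of_forall fun δ => δ.2⟩
  have h2 := Real.tendsto_exp_atBot.comp
    ((Real.tendsto_log_nhdsGT_zero.comp h1).atBot_mul_const hd)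
  rw [tendsto_zero_iff_norm_tendsto_zero]
  refine h2.congr fun δ => ?_
  rw [Complex.norm_exp, ← Complex.ofReal_mul, Complex.ofReal_re]
  rfl

/-- Each point of the limit amoeba is approximated by amoeba points: the substitution
`x = δ^g x'`, where `g` supports the cell `S`, turns the equation of the curve into a small
perturbation of the equation of `C_S`. -/
theorem eventually_nonempty_inter (hΔ : IsLatticePolygon Δ) {w : Δ → ℤ}
    (hZ : IsSimplicial (subdivision fun m => (w m : ℝ))) {a : Δ → ℂˣ} {x : Pl}
    (hx : x ∈ limitAmoeba a (subdivision fun m => (w m : ℝ))) {V : Set Pl} (hV : V ∈ 𝓝 x) :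
    ∀ᶠ δ in comap ((↑) : Set.Ioi (0 : ℝ) → ℝ) (𝓝 0), (amoeba Δ a w δ ∩ V).Nonempty := by
  classical
  have := hΔ.nonempty
  obtain ⟨S, hS, x₀, hx₀, rfl⟩ := Set.mem_iUnion₂.1 hx
  obtain ⟨⟨m₁, hm₁⟩, g, c, hg⟩ := mem_subdivision_iff.1 hS
  have hx₀' : ∑ m ∈ S, (a m : ℂ) * monomial x₀ m = 0 := hx₀
  -- moving `x₀` in the direction `ξ` changes, up to a common factor, only the monomial of `m₁`
  obtain ⟨ξ, c', hξ⟩ := exists_affine_interpolation (hZ S hS)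
    (fun m => if m = m₁ then (1 : ℂ) else 0)
  let s₀ : Δ → ℂ := fun m => if m ∈ S then 1 else 0
  have hsum : ∀ f : Δ → ℂ, ∑ m, s₀ m * f m = ∑ m ∈ S, f m := fun f => by
    simp only [s₀, ite_mul, one_mul, zero_mul]
    rw [Finset.sum_ite_mem, Finset.univ_inter]
  have h0 : ∑ m, s₀ m * ((a m : ℂ) * monomial x₀ m) = 0 := (hsum _).trans hx₀'
  have h1 : ∑ m, s₀ m * ((a m : ℂ) * monomial x₀ m) * ξ (toPl (m : Lat)) ≠ 0 := by
    have h2 : ∑ m, s₀ m * ((a m : ℂ) * monomial x₀ m) * ξ (toPl (m : Lat)) =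
        (a m₁ : ℂ) * monomial x₀ m₁ := by
      simp only [mul_assoc (s₀ _)]
      rw [hsum]
      calc ∑ m ∈ S, (a m : ℂ) * monomial x₀ m * ξ (toPl (m : Lat))
          = ∑ m ∈ S, ((if m = m₁ then (a m : ℂ) * monomial x₀ m else 0) -
              c' * ((a m : ℂ) * monomial x₀ m)) := by
            refine Finset.sum_congr rfl fun m hm => ?_
            rw [eq_sub_of_add_eq (hξ m hm)]
            split_ifs <;> ring
        _ = (a m₁ : ℂ) * monomial x₀ m₁ := by
            rw [Finset.sum_sub_distrib, ← Finset.mul_sum, hx₀', mul_zero, sub_zero,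
              Finset.sum_ite_eq' S m₁, if_pos hm₁]
    rw [h2]
    exact mul_ne_zero (a m₁).ne_zero (monomial_ne_zero x₀ m₁)
  let Y : ℂ × (Δ → ℂ) → Δ → ℂ := fun p m =>
    p.2 m * (monomial x₀ m * Complex.exp (p.1 * ξ (toPl (m : Lat))))
  have hY0 : ∀ m ∈ S, Y (0, s₀) m = monomial x₀ m := fun m hm => by
    simp [Y, s₀, hm]
  have hY1 : ∀ m ∉ S, Y (0, s₀) m = 0 := fun m hm => by
    simp [Y, s₀, hm]
  have hYsum : ∑ m, ‖Y (0, s₀) m‖ ^ 2 = ∑ m ∈ S, ‖Y (0, s₀) m‖ ^ 2 :=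
    (Finset.sum_subset (Finset.subset_univ S) fun m _ hm => by
      rw [hY1 m hm, norm_zero, zero_pow two_ne_zero]).symm
  have hmean : weightedMean Finset.univ (Y (0, s₀)) = weightedMean S (monomial x₀) := by
    rw [← weightedMean_congr hY0, weightedMean, weightedMean, hYsum,
      ← Finset.sum_subset (Finset.subset_univ S)]
    intro m _ hm
    rw [hY1 m hm]
    simp
  have hP : ∀ᶠ p in 𝓝 ((0 : ℂ), s₀), weightedMean Finset.univ (Y p) ∈ V := by
    have hcont : ContinuousAt (fun p => weightedMean Finset.univ (Y p)) (0, s₀) := by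
      refine continuousAt_weightedMean (fun m => ?_) ?_
      · have : Continuous fun p => Y p m := by fun_prop
        exact this.continuousAt
      · rw [hYsum, Finset.sum_congr rfl fun m hm => by rw [hY0 m hm]]
        exact sum_norm_monomial_ne_zero ⟨m₁, hm₁⟩ x₀
    refine hcont ?_
    dsimp only
    rw [hmean]
    exact hV
  have hzero := eventually_exists_zero (fun m => (a m : ℂ) * monomial x₀ m)
    (fun m => ξ (toPl (m : Lat))) s₀ h0 h1 hP
  let s : Set.Ioi (0 : ℝ) → Δ → ℂ := fun δ m =>
    Complex.exp ((Real.log δ : ℂ) * ((w m + g (toPl (m : Lat)) - c : ℝ) : ℂ))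
  have hs : Tendsto s (comap (↑) (𝓝 (0 : ℝ))) (𝓝 s₀) := by
    rw [tendsto_pi_nhds]
    intro m
    by_cases hm : m ∈ S
    · have h2 := (hg m).2.1 hm
      simp only [s, s₀, h2, sub_self, Complex.ofReal_zero, mul_zero, Complex.exp_zero, if_pos hm]
      exact tendsto_const_nhds
    · have h2 : 0 < w m + g (toPl (m : Lat)) - c :=
        sub_pos.2 (lt_of_le_of_ne (hg m).1 fun h => hm ((hg m).2.2 h.symm))
      simp only [s, s₀, if_neg hm]
      exact tendsto_exp_log_mul h2
  filter_upwards [hs.eventually hzero] with δ hδ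
  obtain ⟨t, ht, htV⟩ := hδ
  have hδ0 : (0 : ℝ) < δ := δ.2
  let y : Torus Lat := x₀ * expPoint
    (restrict (t • ξ + (Real.log δ : ℂ) • Complex.ofRealLI.toLinearMap ∘ₗ g))
  have hy : ∀ m : Δ, ((δ : ℝ) : ℂ) ^ w m * monomial y m =
      Complex.exp ((Real.log δ : ℂ) * c) * Y (t, s δ) m := by
    intro m
    have h3 : monomial y m = monomial x₀ m *
        Complex.exp (t * ξ (toPl (m : Lat)) + (Real.log δ : ℂ) * (g (toPl (m : Lat)) : ℂ)) := rfl
    have h4 : ((δ : ℝ) : ℂ) = Complex.exp (Real.log δ : ℂ) := by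
      rw [← Complex.ofReal_exp, Real.exp_log hδ0]
    have h5 : ((δ : ℝ) : ℂ) ^ w m = Complex.exp ((Real.log δ : ℂ) * w m) := by
      rw [h4, ← Complex.exp_int_mul, mul_comm]
    have h6 : Complex.exp ((Real.log δ : ℂ) * w m) *
        Complex.exp (t * ξ (toPl (m : Lat)) + (Real.log δ : ℂ) * (g (toPl (m : Lat)) : ℂ)) =
        Complex.exp ((Real.log δ : ℂ) * c) * (s δ m * Complex.exp (t * ξ (toPl (m : Lat)))) := by
      simp only [s]
      rw [← Complex.exp_add, ← Complex.exp_add, ← Complex.exp_add]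
      congr 1
      push_cast
      ring
    rw [h3, h5, mul_left_comm, h6]
    simp only [Y]
    ring
  have hmem : weightedMean Finset.univ (fun m => ((δ : ℝ) : ℂ) ^ w m * monomial y m) ∈
      amoeba Δ a w δ := by
    refine mem_amoeba_of_torus hΔ ?_
    simp only [hy]
    rw [← mul_zero (Complex.exp ((Real.log δ : ℂ) * c)), ← ht, Finset.mul_sum]
    refine Finset.sum_congr rfl fun m _ => ?_
    simp only [Y]
    ring
  refine ⟨_, hmem, ?_⟩
  simp only [hy]
  rw [weightedMean_mul _ _ _ (Complex.exp_ne_zero _)]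
  exact htV

end LowerLimit

/-! ### Hausdorff convergence -/

/-- Sets that eventually lie in every neighborhood of a compact set and meet every neighborhood of
each of its points converge to it in the Hausdorff distance. -/
theorem tendsto_hausdorffEDist {α X : Type*} [PseudoEMetricSpace X] {l : Filter α} {A : α → Set X}
    {K : Set X} (hK : IsCompact K) (hup : ∀ U, IsOpen U → K ⊆ U → ∀ᶠ i in l, A i ⊆ U)
    (hlow : ∀ x ∈ K, ∀ V ∈ 𝓝 x, ∀ᶠ i in l, (A i ∩ V).Nonempty) :
    Tendsto (fun i => Metric.hausdorffEDist (A i) K) l (𝓝 0) := by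
  rw [ENNReal.tendsto_nhds_zero]
  intro ε hε
  have hU : IsOpen {x | Metric.infEDist x K < ε} :=
    isOpen_lt Metric.continuous_infEDist continuous_const
  have h1 := hup _ hU fun x hx => by
    change Metric.infEDist x K < ε
    rwa [Metric.infEDist_zero_of_mem hx]
  have hε2 : 0 < ε / 2 := ENNReal.half_pos hε.ne'
  obtain ⟨t, htK, hKt⟩ := hK.elim_nhds_subcover (fun x => Metric.eball x (ε / 2))
    fun x _ => Metric.eball_mem_nhds x hε2
  have h2 : ∀ᶠ i in l, ∀ x ∈ t, (A i ∩ Metric.eball x (ε / 2)).Nonempty :=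
    (Filter.eventually_all_finset t).2 fun x hx => hlow x (htK x hx) _ (Metric.eball_mem_nhds x hε2)
  filter_upwards [h1, h2] with i hi1 hi2
  refine Metric.hausdorffEDist_le_of_infEDist (fun x hx => (hi1 hx).le) fun x hx => ?_
  obtain ⟨z, hz, hxz⟩ := Set.mem_iUnion₂.1 (hKt hx)
  obtain ⟨y, hy, hyz⟩ := hi2 z hz
  calc Metric.infEDist x (A i) ≤ edist x y := Metric.infEDist_le_edist_of_mem hy
    _ ≤ edist x z + edist z y := edist_triangle _ _ _
    _ ≤ ε / 2 + ε / 2 := add_le_add (Metric.mem_eball.1 hxz).le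
      (by rw [edist_comm]; exact (Metric.mem_eball.1 hyz).le)
    _ = ε := ENNReal.add_halves ε

end Amoeba

theorem mainTheorem2 (Δ : Finset Amoeba.Lat) (hΔ : Amoeba.IsLatticePolygon Δ)
    (Z : Amoeba.RegularTriangulation Δ)
    (a : Δ → ℂˣ) (ha : ∀ m, ‖(a m : ℂ)‖ = 1) (w : Δ → ℤ)
    (hlim : Filter.Tendsto (fun δ : Set.Ioi (0 : ℝ) => Amoeba.moduliPoint Z (Amoeba.scaled a w δ))
      (Filter.comap ((↑) : Set.Ioi (0 : ℝ) → ℝ) (nhds 0)) (nhds (Amoeba.largeComplexLimit Z))) :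
    Filter.Tendsto
        (fun δ : Set.Ioi (0 : ℝ) =>
          Metric.hausdorffEDist (Amoeba.amoeba Δ a w δ) (Amoeba.limitAmoeba a Z.1))
        (Filter.comap ((↑) : Set.Ioi (0 : ℝ) → ℝ) (nhds 0)) (nhds 0) ∧
      Amoeba.IsFattening (Amoeba.polygon Δ) (Amoeba.limitAmoeba a Z.1) (Amoeba.graph Z.1) := by
  have hw := Amoeba.subdivision_eq_of_tendsto hΔ Z a ha w hlim
  have hZ : Amoeba.IsSimplicial (Amoeba.subdivision fun m => (w m : ℝ)) := hw ▸ Z.2.1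
  rw [← hw]
  have hfat := Amoeba.isFattening_limitAmoeba hΔ hZ ha
  exact ⟨Amoeba.tendsto_hausdorffEDist hfat.1
    (fun U hU hsub => Amoeba.eventually_amoeba_subset hΔ hZ ha hU hsub)
    (fun x hx V hV => Amoeba.eventually_nonempty_inter hΔ hZ hx hV), hfat⟩
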